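/- Notation. Let $d\ge1$, $s\in(0,1)$, $\lambda,\Lambda>0$, $\rho\ge0$, and let $B_r(x)$ be the open Euclidean ball in $\mathbb R^d$, $B_r=B_r(0)$. Let $\mathcal K_\rho$ be the set of measurable $K\colon\mathbb R^d\to[0,\infty)$ with \[K(y)\ge\lambda\min\{|y|^{-d-2s},\rho^{-d-2s}\}\ (y\ne0),\qquad \int_{B_{2r}\setminus B_r}K(y)\,dy\le\Lambda r^{-2s}\ (r>0),\] where $\rho^{-d-2s}=\infty$ if $\rho=0$, and, if $s=1/2$, in addition $\int_{B_{2r}\setminus B_r}yK(y)\,dy=0$ for all $r>0$. Put \[\delta_yu(x)=\begin{cases}u(x+y)-u(x),&s<1/2,\\u(x+y)-u(x)-y\cdot\nabla u(x)\mathbf 1_{B_1}(y),&s=1/2,\\u(x+y)-u(x)-y\cdot\nabla u(x),&s>1/2,\end{cases}\] $L_Ku(x)=\int_{\mathbb R^d}\delta_yu(x)K(y)\,dy$, $\mathcal M_\rho^+u=\sup_{K\in\mathcal K_\rho}L_Ku$ and $\mathcal M_\rho^-u=\inf_{K\in\mathcal K_\rho}L_Ku$ (with $\sup\emptyset=-\infty$,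 $\inf\emptyset=+\infty$). Viscosity solutions. Let $u\in L^\infty(\mathbb R^d)$ and let $\Omega\subseteq\mathbb R^d$ be open. The function $u$ satisfies $F(u)\ge f$ in $\Omega$ in the viscosity sense if $u$ is upper semicontinuous in $\Omega$ and, whenever $B_\varepsilon(x_0)\subseteq\Omega$, $\varepsilon>0$, and $\varphi\in C^{1,1}(B_\varepsilon(x_0))$ satisfies $\varphi(x_0)=u(x_0)$ and $u\le\varphi$ in $B_\varepsilon(x_0)$, the function $v$ that equals $\varphi$ in $B_\varepsilon(x_0)$ and $u$ elsewhere satisfies $F(v)(x_0)\ge f(x_0)$. It satisfies $F(u)\le f$ in $\Omega$ in the viscosity sense if $u$ is lower semicontinuous in $\Omega$ and, whenever $\varphi$ is as above but with $u\ge\varphi$ in $B_\varepsilon(x_0)$, one has $F(v)(x_0)\le f(x_0)$. Theorem. Let $d\ge1$, $s\in(0,1)$ and $\lambda,\Lambda>0$. (a) Let $s\ge1/2$ and $R_0>0$. There exist $\alpha\in(0,2s)$ and $C>0$, depending only on $d,s,\lambda,\Lambda$ and $R_0$, such that for all $\rho\ge0$, $A\ge0$, $R\in(2\rho,R_0]$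 and every $u\in L^\infty(\mathbb R^d)$ satisfying \[\mathcal M_\rho^+u+\Lambda|\nabla u|\ge-A\quad\text{and}\quad\mathcal M_\rho^-u-\Lambda|\nabla u|\le A\quad\text{in }B_R\] in the viscosity sense, \[\sup_{\substack{x,y\in B_{R/4},\ x\neq y\\|x-y|\ge\rho}}\frac{|u(x)-u(y)|}{|x-y|^\alpha}\le\frac C{R^\alpha}\left(\|u\|_{L^\infty(\mathbb R^d)}+R^{2s}A\right).\qquad(*)\] (b) There exist $\alpha\in(0,2s)$ and $C>0$, depending only on $d,s,\lambda$ and $\Lambda$, such that for all $\rho\ge0$, $A\ge0$, $R>2\rho$ and every $u\in L^\infty(\mathbb R^d)$ satisfying \[\mathcal M_\rho^+u\ge-A\quad\text{and}\quad\mathcal M_\rho^-u\le A\quad\text{in }B_R\] in the viscosity sense, the estimate $(*)$ holds. -/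

import Mathlib

open MeasureTheory Set Metric

open scoped ENNReal NNReal

noncomputable section

namespace PartialHolder

/-- Euclidean space `ℝ^d`. -/
abbrev Rd (d : ℕ) : Type := EuclideanSpace ℝ (Fin d)

/-- The truncated profile `min {|y|^(-d-2s), ρ^(-d-2s)}` for `y ≠ 0`, with the convention that
`ρ^(-d-2s) = ∞` if `ρ = 0`. It is written as `(max {|y|, ρ})^(-d-2s)`, which is the same for
`y ≠ 0` and `ρ ≥ 0` (see `profile_zero` and `profile_of_pos`). -/
def profile (d : ℕ) (s ρ : ℝ) (y : Rd d) : ℝ :=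
  (max ‖y‖ ρ) ^ (-(d : ℝ) - 2 * s)

theorem profile_zero (d : ℕ) (s : ℝ) (y : Rd d) :
    profile d s 0 y = ‖y‖ ^ (-(d : ℝ) - 2 * s) := by
  rw [profile, max_eq_left (norm_nonneg y)]

theorem profile_of_pos (d : ℕ) {s ρ : ℝ} (hs : 0 < s) (hρ : 0 < ρ) {y : Rd d} (hy : y ≠ 0) :
    profile d s ρ y = min (‖y‖ ^ (-(d : ℝ) - 2 * s)) (ρ ^ (-(d : ℝ) - 2 * s)) := by
  have hy' : 0 < ‖y‖ := norm_pos_iff.mpr hy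
  have he : -(d : ℝ) - 2 * s ≤ 0 := by
    have : (0 : ℝ) ≤ d := Nat.cast_nonneg d
    linarith
  rcases le_total ‖y‖ ρ with h | h
  · rw [profile, max_eq_right h, min_eq_right (Real.rpow_le_rpow_of_nonpos hy' h he)]
  · rw [profile, max_eq_left h, min_eq_left (Real.rpow_le_rpow_of_nonpos hρ h he)]

/-- The dyadic annulus `B_{2r} \ B_r`. -/
def annulus (d : ℕ) (r : ℝ) : Set (Rd d) := ball 0 (2 * r) \ ball 0 r

/-- Membership in the class `𝒦_ρ` of admissible kernels `K : ℝ^d → [0, ∞)` of order `2s` with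
ellipticity constants `lam`, `Lam` and truncation parameter `ρ ≥ 0`. -/
structure IsAdmissibleKernel (d : ℕ) (s lam Lam ρ : ℝ) (K : Rd d → ℝ) : Prop where
  aemeasurable : AEMeasurable K volume
  nonneg : ∀ y, 0 ≤ K y
  lower : ∀ y, y ≠ 0 → lam * profile d s ρ y ≤ K y
  upper : ∀ r : ℝ, 0 < r →
    ∫⁻ y in annulus d r, ENNReal.ofReal (K y) ≤ ENNReal.ofReal (Lam * r ^ (-(2 * s)))
  cancel : s = 1 / 2 → ∀ r : ℝ, 0 < r → ∫ y in annulus d r, K y • y = 0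

/-- The difference operator `δ_y u(x)`. -/
def delta {d : ℕ} (s : ℝ) (u : Rd d → ℝ) (x y : Rd d) : ℝ :=
  if s < 1 / 2 then u (x + y) - u x
  else if s = 1 / 2 then
    u (x + y) - u x - (if ‖y‖ < 1 then inner ℝ (gradient u x) y else 0)
  else u (x + y) - u x - inner ℝ (gradient u x) y

open Classical in
/-- The function `φ` in `B_ε(x₀)`, and `u` elsewhere. -/
def glue {d : ℕ} (x₀ : Rd d) (ε : ℝ) (φ u : Rd d → ℝ) : Rd d → ℝ :=
  (ball x₀ ε).piecewise φ u

/-- The operator `L_K u(x) = ∫ δ_y u(x) K(y) dy`. -/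
def linOp {d : ℕ} (s : ℝ) (K u : Rd d → ℝ) (x : Rd d) : ℝ :=
  ∫ y, delta s u x y * K y

/-- The Pucci operator `𝓜_ρ^+ u(x) = sup_{K ∈ 𝒦_ρ} L_K u(x)`, as an extended real. -/
def pucciPlus {d : ℕ} (s lam Lam ρ : ℝ) (u : Rd d → ℝ) (x : Rd d) : EReal :=
  ⨆ (K : Rd d → ℝ) (_ : IsAdmissibleKernel d s lam Lam ρ K), (linOp s K u x : EReal)

/-- The Pucci operator `𝓜_ρ^- u(x) = inf_{K ∈ 𝒦_ρ} L_K u(x)`, as an extended real. -/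
def pucciMinus {d : ℕ} (s lam Lam ρ : ℝ) (u : Rd d → ℝ) (x : Rd d) : EReal :=
  ⨅ (K : Rd d → ℝ) (_ : IsAdmissibleKernel d s lam Lam ρ K), (linOp s K u x : EReal)

/-- `φ` is of class `C^{1,1}` in the ball `B_ε(x₀)`. -/
def IsC11OnBall {d : ℕ} (φ : Rd d → ℝ) (x₀ : Rd d) (ε : ℝ) : Prop :=
  DifferentiableOn ℝ φ (ball x₀ ε) ∧
    ∃ L : ℝ≥0, LipschitzOnWith L (gradient φ) (ball x₀ ε)

/-- `u ∈ L^∞(ℝ^d)`, upper semicontinuous in `Ω`, satisfies `F(u) ≥ f` in `Ω` in the viscosity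
sense. -/
def ViscosityGE {d : ℕ} (F : (Rd d → ℝ) → Rd d → EReal) (f : Rd d → ℝ) (Ω : Set (Rd d))
    (u : Rd d → ℝ) : Prop :=
  MemLp u ∞ volume ∧ UpperSemicontinuousOn u Ω ∧
    ∀ x₀ ∈ Ω, ∀ ε : ℝ, 0 < ε → ball x₀ ε ⊆ Ω →
      ∀ φ : Rd d → ℝ, IsC11OnBall φ x₀ ε → u x₀ = φ x₀ → (∀ x ∈ ball x₀ ε, u x ≤ φ x) →
        (f x₀ : EReal) ≤ F (glue x₀ ε φ u) x₀

/-- `u ∈ L^∞(ℝ^d)`, lower semicontinuous in `Ω`, satisfies `F(u) ≤ f` in `Ω` in the viscosity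
sense. -/
def ViscosityLE {d : ℕ} (F : (Rd d → ℝ) → Rd d → EReal) (f : Rd d → ℝ) (Ω : Set (Rd d))
    (u : Rd d → ℝ) : Prop :=
  MemLp u ∞ volume ∧ LowerSemicontinuousOn u Ω ∧
    ∀ x₀ ∈ Ω, ∀ ε : ℝ, 0 < ε → ball x₀ ε ⊆ Ω →
      ∀ φ : Rd d → ℝ, IsC11OnBall φ x₀ ε → u x₀ = φ x₀ → (∀ x ∈ ball x₀ ε, φ x ≤ u x) →
        F (glue x₀ ε φ u) x₀ ≤ (f x₀ : EReal)

/-- The extremal operator with drift `𝓜_ρ^+ u + Lam |∇u|`. -/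
def driftPlus {d : ℕ} (s lam Lam ρ : ℝ) (u : Rd d → ℝ) (x : Rd d) : EReal :=
  pucciPlus s lam Lam ρ u x + ((Lam * ‖gradient u x‖ : ℝ) : EReal)

/-- The extremal operator with drift `𝓜_ρ^- u - Lam |∇u|`. -/
def driftMinus {d : ℕ} (s lam Lam ρ : ℝ) (u : Rd d → ℝ) (x : Rd d) : EReal :=
  pucciMinus s lam Lam ρ u x - ((Lam * ‖gradient u x‖ : ℝ) : EReal)

/-- The norm of `u` in `L^∞(ℝ^d)`. -/
def supNorm {d : ℕ} (u : Rd d → ℝ) : ℝ := (eLpNorm u ∞ volume).toReal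

/-- The partial Hölder estimate down to scale `ρ`:
`sup {|u(x) - u(y)| / |x - y|^α : x ≠ y ∈ B_{R/4}, |x - y| ≥ ρ}
  ≤ C R^{-α} (‖u‖_{L^∞(ℝ^d)} + R^{2s} A)`. -/
def HolderEstimate {d : ℕ} (s ρ R A α C : ℝ) (u : Rd d → ℝ) : Prop :=
  ∀ x ∈ ball (0 : Rd d) (R / 4), ∀ y ∈ ball (0 : Rd d) (R / 4), x ≠ y → ρ ≤ ‖x - y‖ →
    |u x - u y| / ‖x - y‖ ^ α ≤ C / R ^ α * (supNorm u + R ^ (2 * s) * A)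

end PartialHolder

end

noncomputable section

namespace PartialHolder

/-! Kernels in the class are bounded below pointwise, so neither an ABP estimate nor a barrier is
needed: at a touching point the operator sees every set of positive measure on which `u` is small.
Suppose `u ≤ c + h` in a ball of radius `4κ`, with controlled growth outside, and `u ≤ c` on half of
the concentric ball of radius `κ`. If `u` exceeded `c + (1 - θ)h` in the small ball, a paraboloid of
height `θh` would touch it from above nearby. Testing there, the paraboloid and the compensator cost
a multiple of `θhκ^(-2s)`, the growth at infinity a multiple of `αhκ^(-2s)`, and the drift a
multiple of `θh/κ`. The half ball contributes `-g h κ^(-2s)` with `g` = `gainConst`. For small `θ`,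
`α` and `A` this is impossible: that is `growth_lemma`.

Applied to `u` or `-u`, it shrinks the oscillation by `4^(-α)` when the radius shrinks by 4
(`OscBound.step`), and `oscBound_iterate` repeats this while `ρ ≤ 8κ`. Below that scale the
truncation spoils the lower bound on the kernel, so the estimate stops at distance `ρ`.

Relative to diffusion the drift scales like `κ^(2s-1)`, which stays bounded for `κ ≤ R₀` when `s ≥
1/2`. If `s = 1/2`, the compensator is cut off at radius 1 instead of `κ`; the cancellation
condition allows moving this radius by powers of 2. -/

/-! ### Dyadic annuli and moments of admissible kernels. -/

theorem measurableSet_annulus (d : ℕ) (r : ℝ) : MeasurableSet (annulus d r) :=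
  measurableSet_ball.diff measurableSet_ball

theorem mem_annulus {d : ℕ} {r : ℝ} {y : Rd d} : y ∈ annulus d r ↔ r ≤ ‖y‖ ∧ ‖y‖ < 2 * r := by
  simp [annulus, and_comm]

theorem ball_diff_zero_subset {d : ℕ} {r : ℝ} :
    ball (0 : Rd d) r ⊆ {0} ∪ ⋃ n : ℕ, annulus d (r / 2 * (1 / 2) ^ n) := by
  intro y hy
  rw [mem_ball_zero_iff] at hy
  by_cases h0 : y = 0
  · exact Or.inl h0
  right
  have hy0 : 0 < ‖y‖ := norm_pos_iff.mpr h0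
  have hr : 0 < r := hy0.trans hy
  obtain ⟨k, hk1, hk2⟩ := exists_nat_pow_near (x := r / ‖y‖) (y := 2)
    (by rw [le_div_iff₀ hy0]; linarith) (by norm_num)
  rw [le_div_iff₀ hy0] at hk1
  rw [div_lt_iff₀ hy0] at hk2
  have hkp : (0 : ℝ) < 2 ^ k := by positivity
  have key : (1 / 2 : ℝ) ^ k * 2 ^ k = 1 := by rw [← mul_pow]; norm_num
  have key' : (0 : ℝ) < (1 / 2 : ℝ) ^ k := by positivity
  rw [mem_iUnion]
  -- An annulus contains its inner sphere but not its outer one, so `‖y‖ = r / 2 ^ k` belongs to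
  -- index `k - 1`; `k = 0` is excluded by `‖y‖ < r`.
  rcases hk1.lt_or_eq with h | h
  · refine ⟨k, mem_annulus.mpr ⟨?_, ?_⟩⟩
    · rw [pow_succ] at hk2
      nlinarith
    · nlinarith
  · rcases k with _ | k
    · simp at h; linarith
    · refine ⟨k, mem_annulus.mpr ⟨?_, ?_⟩⟩
      · have h2 : r = 2 * 2 ^ k * ‖y‖ := by rw [← h, pow_succ]; ring
        have key2 : (1 / 2 : ℝ) ^ k * 2 ^ k = 1 := by rw [← mul_pow]; norm_num
        rw [h2]
        have : 2 * 2 ^ k * ‖y‖ / 2 * (1 / 2) ^ k = ‖y‖ * ((1 / 2 : ℝ) ^ k * 2 ^ k) := by ring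
        rw [this, key2, mul_one]
      · have h2 : r = 2 * 2 ^ k * ‖y‖ := by rw [← h, pow_succ]; ring
        have key2 : (1 / 2 : ℝ) ^ k * 2 ^ k = 1 := by rw [← mul_pow]; norm_num
        rw [h2]
        have : 2 * (2 * 2 ^ k * ‖y‖ / 2 * (1 / 2) ^ k) = 2 * ‖y‖ * ((1 / 2 : ℝ) ^ k * 2 ^ k) := by
          ring
        rw [this, key2]
        linarith

theorem compl_ball_subset {d : ℕ} {r : ℝ} (hr : 0 < r) :
    (ball (0 : Rd d) r)ᶜ ⊆ ⋃ n : ℕ, annulus d (r * 2 ^ n) := by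
  intro y hy
  rw [mem_compl_iff, mem_ball_zero_iff, not_lt] at hy
  obtain ⟨k, hk1, hk2⟩ := exists_nat_pow_near (x := ‖y‖ / r) (y := 2)
    (by rw [le_div_iff₀ hr]; linarith) (by norm_num)
  rw [le_div_iff₀ hr] at hk1
  rw [div_lt_iff₀ hr] at hk2
  rw [mem_iUnion]
  refine ⟨k, mem_annulus.mpr ⟨by linarith, ?_⟩⟩
  rw [pow_succ] at hk2
  linarith

variable {d : ℕ} {s lam Lam ρ : ℝ} {K : Rd d → ℝ}

theorem IsAdmissibleKernel.lintegral_annulus_le (hK : IsAdmissibleKernel d s lam Lam ρ K)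
    {p a : ℝ} (hp : 0 ≤ p) (ha : 0 < a) :
    ∫⁻ y in annulus d a, ENNReal.ofReal (‖y‖ ^ p * K y) ≤
      ENNReal.ofReal (2 ^ p * Lam * a ^ (p - 2 * s)) := by
  calc ∫⁻ y in annulus d a, ENNReal.ofReal (‖y‖ ^ p * K y)
      ≤ ∫⁻ y in annulus d a, ENNReal.ofReal ((2 * a) ^ p) * ENNReal.ofReal (K y) := by
        refine setLIntegral_mono' (measurableSet_annulus d a) fun y hy => ?_
        rw [← ENNReal.ofReal_mul (by positivity)]
        refine ENNReal.ofReal_le_ofReal (mul_le_mul_of_nonneg_right ?_ (hK.nonneg y))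
        exact Real.rpow_le_rpow (norm_nonneg y) (mem_annulus.mp hy).2.le hp
    _ = ENNReal.ofReal ((2 * a) ^ p) * ∫⁻ y in annulus d a, ENNReal.ofReal (K y) :=
        lintegral_const_mul'' _ hK.aemeasurable.restrict.ennreal_ofReal
    _ ≤ ENNReal.ofReal ((2 * a) ^ p) * ENNReal.ofReal (Lam * a ^ (-(2 * s))) := by
        gcongr; exact hK.upper a ha
    _ = ENNReal.ofReal (2 ^ p * Lam * a ^ (p - 2 * s)) := by
        rw [← ENNReal.ofReal_mul (by positivity), Real.mul_rpow zero_le_two ha.le, sub_eq_add_neg,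
          Real.rpow_add ha]
        ring_nf

/-- A geometric series of ratio `b ^ (p - 2s)`: `b = 1/2` with `p > 2s` sums towards the origin, `b
= 2` with `p < 2s` towards infinity. -/
theorem IsAdmissibleKernel.lintegral_iUnion_annulus_le (hK : IsAdmissibleKernel d s lam Lam ρ K)
    (hLam : 0 < Lam) {p a b : ℝ} (hp : 0 ≤ p) (ha : 0 < a) (hb : 0 < b)
    (hb1 : b ^ (p - 2 * s) < 1) :
    ∫⁻ y in ⋃ n : ℕ, annulus d (a * b ^ n), ENNReal.ofReal (‖y‖ ^ p * K y) ≤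
      ENNReal.ofReal (2 ^ p / (1 - b ^ (p - 2 * s)) * Lam * a ^ (p - 2 * s)) := by
  have hb0 : 0 < b ^ (p - 2 * s) := Real.rpow_pos_of_pos hb _
  calc ∫⁻ y in ⋃ n : ℕ, annulus d (a * b ^ n), ENNReal.ofReal (‖y‖ ^ p * K y)
      ≤ ∑' n : ℕ, ∫⁻ y in annulus d (a * b ^ n), ENNReal.ofReal (‖y‖ ^ p * K y) :=
        lintegral_iUnion_le _ _
    _ ≤ ∑' n : ℕ, ENNReal.ofReal (2 ^ p * Lam * a ^ (p - 2 * s) * (b ^ (p - 2 * s)) ^ n) := by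
        refine ENNReal.tsum_le_tsum fun n => ?_
        refine (hK.lintegral_annulus_le hp (by positivity)).trans (le_of_eq ?_)
        rw [Real.mul_rpow ha.le (by positivity), ← Real.rpow_natCast b n,
          ← Real.rpow_natCast (b ^ (p - 2 * s)) n, ← Real.rpow_mul hb.le, ← Real.rpow_mul hb.le,
          mul_comm (n : ℝ)]
        ring_nf
    _ = _ := by
        rw [← ENNReal.ofReal_tsum_of_nonneg (fun n => by positivity)
          ((summable_geometric_of_lt_one hb0.le hb1).mul_left _), tsum_mul_left,
          tsum_geometric_of_lt_one hb0.le hb1]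
        congr 1
        field_simp

/-- Constant in the moment bounds for admissible kernels. -/
def momentConst (s p : ℝ) : ℝ := 2 ^ p / (1 - 2 ^ (-|p - 2 * s|))

theorem momentConst_pos {p : ℝ} (h : p ≠ 2 * s) : 0 < momentConst s p := by
  have : (2 : ℝ) ^ (-|p - 2 * s|) < 1 :=
    Real.rpow_lt_one_of_one_lt_of_neg one_lt_two (by simpa [sub_eq_zero] using h)
  have : 0 < 1 - (2 : ℝ) ^ (-|p - 2 * s|) := by linarith
  unfold momentConst
  positivity

theorem IsAdmissibleKernel.lintegral_ball_le (hK : IsAdmissibleKernel d s lam Lam ρ K)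
    (hLam : 0 < Lam) {p r : ℝ} (hp0 : 0 < p) (hp : 2 * s < p) (hr : 0 < r) :
    ∫⁻ y in ball 0 r, ENNReal.ofReal (‖y‖ ^ p * K y) ≤
      ENNReal.ofReal (momentConst s p * Lam * r ^ (p - 2 * s)) := by
  have hb : (1 / 2 : ℝ) ^ (p - 2 * s) = 2 ^ (-|p - 2 * s|) := by
    rw [abs_of_pos (by linarith), Real.rpow_neg zero_le_two, one_div, Real.inv_rpow zero_le_two]
  calc ∫⁻ y in ball 0 r, ENNReal.ofReal (‖y‖ ^ p * K y)
      ≤ ∫⁻ y in {0} ∪ ⋃ n : ℕ, annulus d (r / 2 * (1 / 2) ^ n), ENNReal.ofReal (‖y‖ ^ p * K y) :=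
        lintegral_mono_set ball_diff_zero_subset
    _ ≤ (∫⁻ y in {0}, ENNReal.ofReal (‖y‖ ^ p * K y)) +
        ∫⁻ y in ⋃ n : ℕ, annulus d (r / 2 * (1 / 2) ^ n), ENNReal.ofReal (‖y‖ ^ p * K y) :=
        lintegral_union_le _ _ _
    _ ≤ 0 + ENNReal.ofReal (momentConst s p * Lam * (r / 2) ^ (p - 2 * s)) := by
        gcongr
        · rw [lintegral_singleton]
          simp [Real.zero_rpow hp0.ne']
        · refine (hK.lintegral_iUnion_annulus_le hLam hp0.le (by positivity) (by norm_num) ?_).trans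
            ?_
          · exact Real.rpow_lt_one (by norm_num) (by norm_num) (by linarith)
          · rw [hb, momentConst]
    _ ≤ _ := by
        rw [zero_add]
        have := (momentConst_pos (s := s) hp.ne').le
        refine ENNReal.ofReal_le_ofReal (mul_le_mul_of_nonneg_left ?_ (by positivity))
        exact Real.rpow_le_rpow (by positivity) (by linarith) (by linarith)

theorem IsAdmissibleKernel.lintegral_compl_ball_le (hK : IsAdmissibleKernel d s lam Lam ρ K)
    (hLam : 0 < Lam) {p r : ℝ} (hp0 : 0 ≤ p) (hp : p < 2 * s) (hr : 0 < r) :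
    ∫⁻ y in (ball 0 r)ᶜ, ENNReal.ofReal (‖y‖ ^ p * K y) ≤
      ENNReal.ofReal (momentConst s p * Lam * r ^ (p - 2 * s)) := by
  refine (lintegral_mono_set (compl_ball_subset hr)).trans
    ((hK.lintegral_iUnion_annulus_le hLam hp0 hr zero_lt_two ?_).trans (le_of_eq ?_))
  · exact Real.rpow_lt_one_of_one_lt_of_neg one_lt_two (by linarith)
  · rw [momentConst, abs_of_neg (by linarith), neg_neg]

theorem IsAdmissibleKernel.aestronglyMeasurable_rpow_mul
    (hK : IsAdmissibleKernel d s lam Lam ρ K) (p : ℝ) :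
    AEStronglyMeasurable (fun y : Rd d => ‖y‖ ^ p * K y) volume :=
  ((measurable_norm.pow_const p).aemeasurable.mul hK.aemeasurable).aestronglyMeasurable

theorem integrableOn_and_setIntegral_le_of_lintegral_le {X : Type*} [MeasurableSpace X]
    {μ : Measure X} {S : Set X} {f : X → ℝ} {c : ℝ} (hf : AEStronglyMeasurable f μ)
    (h0 : ∀ x, 0 ≤ f x) (hc : 0 ≤ c) (h : ∫⁻ x in S, ENNReal.ofReal (f x) ∂μ ≤ ENNReal.ofReal c) :
    IntegrableOn f S μ ∧ ∫ x in S, f x ∂μ ≤ c := by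
  constructor
  · refine ⟨hf.restrict, ?_⟩
    rw [hasFiniteIntegral_iff_ofReal (Filter.Eventually.of_forall h0)]
    exact h.trans_lt ENNReal.ofReal_lt_top
  · rw [integral_eq_lintegral_of_nonneg_ae (Filter.Eventually.of_forall h0) hf.restrict]
    exact (ENNReal.toReal_mono ENNReal.ofReal_ne_top h).trans (ENNReal.toReal_ofReal hc).le

theorem IsAdmissibleKernel.integral_ball_le (hK : IsAdmissibleKernel d s lam Lam ρ K)
    (hLam : 0 < Lam) {p r : ℝ} (hp0 : 0 < p) (hp : 2 * s < p) (hr : 0 < r) :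
    IntegrableOn (fun y => ‖y‖ ^ p * K y) (ball 0 r) ∧
    ∫ y in ball 0 r, ‖y‖ ^ p * K y ≤ momentConst s p * Lam * r ^ (p - 2 * s) := by
  have := (momentConst_pos (s := s) hp.ne').le
  exact integrableOn_and_setIntegral_le_of_lintegral_le (hK.aestronglyMeasurable_rpow_mul p)
    (fun y => mul_nonneg (by positivity) (hK.nonneg y)) (by positivity)
    (hK.lintegral_ball_le hLam hp0 hp hr)

theorem IsAdmissibleKernel.integral_compl_ball_le (hK : IsAdmissibleKernel d s lam Lam ρ K)
    (hLam : 0 < Lam) {p r : ℝ} (hp0 : 0 ≤ p) (hp : p < 2 * s) (hr : 0 < r) :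
    IntegrableOn (fun y => ‖y‖ ^ p * K y) (ball 0 r)ᶜ ∧
    ∫ y in (ball 0 r)ᶜ, ‖y‖ ^ p * K y ≤ momentConst s p * Lam * r ^ (p - 2 * s) := by
  have := (momentConst_pos (s := s) hp.ne).le
  exact integrableOn_and_setIntegral_le_of_lintegral_le (hK.aestronglyMeasurable_rpow_mul p)
    (fun y => mul_nonneg (by positivity) (hK.nonneg y)) (by positivity)
    (hK.lintegral_compl_ball_le hLam hp0 hp hr)

/-! ### Cancellation and change of the cut-off radius. -/

theorem IsAdmissibleKernel.aestronglyMeasurable_smul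
    (hK : IsAdmissibleKernel d s lam Lam ρ K) :
    AEStronglyMeasurable (fun y : Rd d => K y • y) volume :=
  hK.aemeasurable.aestronglyMeasurable.smul aestronglyMeasurable_id

theorem IsAdmissibleKernel.integrableOn_annulus_smul (hK : IsAdmissibleKernel d s lam Lam ρ K)
    {a : ℝ} (ha : 0 < a) : IntegrableOn (fun y => K y • y) (annulus d a) := by
  refine ⟨hK.aestronglyMeasurable_smul.restrict, ?_⟩
  rw [hasFiniteIntegral_iff_norm]
  have h := hK.lintegral_annulus_le (p := 1) zero_le_one ha
  refine lt_of_le_of_lt (le_of_eq (lintegral_congr fun y => ?_)) (h.trans_lt ENNReal.ofReal_lt_top)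
  rw [norm_smul, Real.norm_of_nonneg (hK.nonneg y), Real.rpow_one, mul_comm]

theorem IsAdmissibleKernel.integral_smul_diff_ball (hK : IsAdmissibleKernel d s lam Lam ρ K)
    (hs : s = 1 / 2) {a : ℝ} (ha : 0 < a) (n : ℕ) :
    IntegrableOn (fun y => K y • y) (ball 0 (2 ^ n * a) \ ball 0 a) ∧
      ∫ y in ball (0 : Rd d) (2 ^ n * a) \ ball 0 a, K y • y = 0 := by
  induction n with
  | zero => simp
  | succ n ih =>
    have h1 : (1 : ℝ) ≤ 2 ^ n := one_le_pow₀ one_le_two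
    have hsplit : ball (0 : Rd d) (2 ^ (n + 1) * a) \ ball 0 a =
        (ball 0 (2 ^ n * a) \ ball 0 a) ∪ annulus d (2 ^ n * a) := by
      have e : (2 : ℝ) ^ (n + 1) * a = 2 * (2 ^ n * a) := by ring
      ext y
      simp only [mem_sdiff, mem_ball_zero_iff, mem_union, mem_annulus, not_lt, e]
      constructor
      · rintro ⟨h, h'⟩
        by_cases h2 : ‖y‖ < 2 ^ n * a
        · exact Or.inl ⟨h2, h'⟩
        · exact Or.inr ⟨not_lt.mp h2, h⟩
      · rintro (⟨h, h'⟩ | ⟨h, h'⟩)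
        · exact ⟨by nlinarith, h'⟩
        · exact ⟨h', by nlinarith⟩
    have hpos : 0 < 2 ^ n * a := by positivity
    have hdisj : Disjoint (ball (0 : Rd d) (2 ^ n * a) \ ball 0 a) (annulus d (2 ^ n * a)) := by
      rw [Set.disjoint_left]
      intro y hy hy'
      exact absurd (mem_ball_zero_iff.mp hy.1) (not_lt.mpr (mem_annulus.mp hy').1)
    rw [hsplit]
    refine ⟨ih.1.union (hK.integrableOn_annulus_smul hpos), ?_⟩
    rw [setIntegral_union hdisj (measurableSet_annulus d _) ih.1 (hK.integrableOn_annulus_smul hpos),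
      ih.2, hK.cancel hs _ hpos, add_zero]

/-- The first order compensator in the definition of `delta`, with cut-off radius `κ` in the
critical case `s = 1 / 2`. -/
def compensator {d : ℕ} (s κ : ℝ) (g y : Rd d) : ℝ :=
  if s < 1 / 2 then 0
  else if s = 1 / 2 then (if ‖y‖ < κ then inner ℝ g y else 0)
  else inner ℝ g y

theorem delta_eq {d : ℕ} (s : ℝ) (u : Rd d → ℝ) (x y : Rd d) :
    delta s u x y = u (x + y) - u x - compensator s 1 (gradient u x) y := by
  unfold delta compensator
  split_ifs <;> simp

theorem measurable_compensator {d : ℕ} (s κ : ℝ) (g : Rd d) :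
    Measurable (compensator s κ g) := by
  have h : Measurable fun y : Rd d => (inner ℝ g y : ℝ) := measurable_const.inner measurable_id
  unfold compensator
  split_ifs
  · exact measurable_const
  · exact Measurable.ite (measurableSet_lt measurable_norm measurable_const) h measurable_const
  · exact h

theorem IsAdmissibleKernel.integral_inner_diff_ball (hK : IsAdmissibleKernel d s lam Lam ρ K)
    (hs : s = 1 / 2) {a : ℝ} (ha : 0 < a) (n : ℕ) (g : Rd d) :
    Integrable (fun y => (compensator s (2 ^ n * a) g y - compensator s a g y) * K y) ∧
      ∫ y, (compensator s (2 ^ n * a) g y - compensator s a g y) * K y = 0 := by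
  have h1 : (1 : ℝ) ≤ 2 ^ n := one_le_pow₀ one_le_two
  have hS : MeasurableSet (ball (0 : Rd d) (2 ^ n * a) \ ball 0 a) :=
    measurableSet_ball.diff measurableSet_ball
  have e : (fun y => (compensator s (2 ^ n * a) g y - compensator s a g y) * K y) =
      (ball (0 : Rd d) (2 ^ n * a) \ ball 0 a).indicator (fun y => inner ℝ g (K y • y)) := by
    ext y
    simp only [compensator, hs, lt_irrefl, if_false, if_true, indicator, mem_sdiff,
      mem_ball_zero_iff, inner_smul_right]
    by_cases h2 : ‖y‖ < a
    · have : ‖y‖ < 2 ^ n * a := by nlinarith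
      simp [h2, this]
    · by_cases h3 : ‖y‖ < 2 ^ n * a <;> simp [h2, mul_comm]
  obtain ⟨hi, h0⟩ := hK.integral_smul_diff_ball hs ha n
  rw [e]
  constructor
  · rw [integrable_indicator_iff hS]
    exact hi.const_inner g
  · rw [integral_indicator hS, integral_inner hi g, h0, inner_zero_right]

/-- For `s = 1/2` the two compensators differ on a union of dyadic annuli, where `K y • y` has zero
integral; hence all radii are kept powers of 2. For other `s` the cut-off plays no role. -/
theorem IsAdmissibleKernel.integral_compensator_sub (hK : IsAdmissibleKernel d s lam Lam ρ K)
    (m : ℤ) (g : Rd d) :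
    Integrable (fun y => (compensator s (2 ^ m) g y - compensator s 1 g y) * K y) ∧
      ∫ y, (compensator s (2 ^ m) g y - compensator s 1 g y) * K y = 0 := by
  by_cases hs : s = 1 / 2
  · obtain ⟨n, rfl | rfl⟩ := m.eq_nat_or_neg
    · have := hK.integral_inner_diff_ball hs one_pos n g
      simpa using this
    · have hp : (0 : ℝ) < 2 ^ (-(n : ℤ)) := by positivity
      have h := hK.integral_inner_diff_ball hs hp n g
      have e : (2 : ℝ) ^ n * 2 ^ (-(n : ℤ)) = 1 := by
        rw [zpow_neg, zpow_natCast, mul_inv_cancel₀ (by positivity)]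
      rw [e] at h
      have e2 : (fun y => (compensator s (2 ^ (-(n : ℤ))) g y - compensator s 1 g y) * K y) =
          fun y => -((compensator s 1 g y - compensator s (2 ^ (-(n : ℤ))) g y) * K y) := by
        ext y; ring
      rw [e2, integral_neg, h.2, neg_zero]
      exact ⟨h.1.neg, rfl⟩
  · have e : (fun y => (compensator s (2 ^ m) g y - compensator s 1 g y) * K y) = fun _ => 0 := by
      ext y
      simp only [compensator, if_neg hs, sub_self, zero_mul]
    rw [e]
    simp

/-! ### Upper bound for the linear operators. -/

/-- The only use of the lower bound on `K`: with `‖y‖ ≤ b` and `ρ ≤ b` the truncated profile is at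
least `b ^ (-d - 2s)`. -/
theorem IsAdmissibleKernel.mul_volume_le_setIntegral (hK : IsAdmissibleKernel d s lam Lam ρ K)
    (hs : 0 < s) (hlam : 0 < lam) (hLam : 0 < Lam) {ε b : ℝ} (hε : 0 < ε) (hρ : ρ ≤ b)
    {G : Set (Rd d)} (hG : NullMeasurableSet G) (hGε : ∀ y ∈ G, ε ≤ ‖y‖) (hGb : ∀ y ∈ G, ‖y‖ ≤ b) :
    IntegrableOn K G ∧ lam * b ^ (-(d : ℝ) - 2 * s) * volume.real G ≤ ∫ y in G, K y := by
  have hint : IntegrableOn K G := by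
    have := (hK.integral_compl_ball_le hLam (p := 0) le_rfl (by linarith) hε).1
    simp only [Real.rpow_zero, one_mul] at this
    exact this.mono_set fun y hy => by simpa using hGε y hy
  refine ⟨hint, ?_⟩
  have hfin : volume G ≠ ∞ := by
    refine ((measure_mono fun y hy => ?_).trans_lt
      (measure_closedBall_lt_top (x := (0 : Rd d)) (r := b))).ne
    simpa using hGb y hy
  calc lam * b ^ (-(d : ℝ) - 2 * s) * volume.real G
      = ∫ y in G, lam * b ^ (-(d : ℝ) - 2 * s) := by
        rw [setIntegral_const, smul_eq_mul, mul_comm]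
    _ ≤ ∫ y in G, K y := by
        refine setIntegral_mono_on₀ ((integrableOn_const_iff).mpr (Or.inr hfin.lt_top)) hint hG ?_
        intro y hy
        have hy0 : 0 < ‖y‖ := hε.trans_le (hGε y hy)
        refine le_trans ?_ (hK.lower y (norm_pos_iff.mp hy0))
        refine mul_le_mul_of_nonneg_left ?_ hlam.le
        refine Real.rpow_le_rpow_of_nonpos (lt_max_of_lt_left hy0) (max_le (hGb y hy) hρ) ?_
        have : (0 : ℝ) ≤ d := Nat.cast_nonneg d
        linarith

/-- The estimate comes from `hnear` and `hfar`. The bounds `hin` and `hout`, whose constants do not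
reach the conclusion, only give integrability, without which the integral would be 0 by default. -/
theorem IsAdmissibleKernel.linOp_le (hK : IsAdmissibleKernel d s lam Lam ρ K)
    (hs : 0 < s) (hlam : 0 < lam) (hLam : 0 < Lam) {v : Rd d → ℝ} {x₀ : Rd d}
    {p q κ ε a₁ a₂ a₃ b c₁ c₂ : ℝ} {m : ℤ} (hκ : κ = 2 ^ m) (hp0 : 0 < p) (hp : 2 * s < p)
    (hq0 : 0 ≤ q) (hq : q < 2 * s) (hε : 0 < ε)
    (ha₁ : 0 ≤ a₁) (ha₂ : 0 ≤ a₂) (ha₃ : 0 ≤ a₃) (hb : 0 ≤ b)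
    (hv : AEStronglyMeasurable v volume)
    (hin : ∀ y, ‖y‖ < ε →
      |v (x₀ + y) - v x₀ - compensator s κ (gradient v x₀) y| ≤ c₁ * ‖y‖ ^ p)
    (hout : ∀ᵐ y, ε ≤ ‖y‖ →
      |v (x₀ + y) - v x₀ - compensator s κ (gradient v x₀) y| ≤ c₂ * ‖y‖ ^ q)
    {G : Set (Rd d)} (hG : NullMeasurableSet G) (hGε : ∀ y ∈ G, ε ≤ ‖y‖)
    (hGκ : ∀ y ∈ G, ‖y‖ ≤ 8 * κ) (hρ : ρ ≤ 8 * κ)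
    (hnear : ∀ᵐ y, ‖y‖ < κ → v (x₀ + y) - v x₀ - compensator s κ (gradient v x₀) y ≤
      a₁ * ‖y‖ ^ p - G.indicator (fun _ => b) y)
    (hfar : ∀ᵐ y, κ ≤ ‖y‖ → v (x₀ + y) - v x₀ - compensator s κ (gradient v x₀) y ≤
      a₂ * ‖y‖ ^ q + a₃ * ‖y‖ ^ s - G.indicator (fun _ => b) y) :
    linOp s K v x₀ ≤ a₁ * (momentConst s p * Lam * κ ^ (p - 2 * s)) +
      (a₂ * (momentConst s q * Lam * κ ^ (q - 2 * s)) +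
        a₃ * (momentConst s s * Lam * κ ^ (s - 2 * s))) -
      b * (lam * (8 * κ) ^ (-(d : ℝ) - 2 * s) * volume.real G) := by
  have hκ0 : 0 < κ := by rw [hκ]; positivity
  set g := gradient v x₀ with hg
  set D : Rd d → ℝ := fun y => v (x₀ + y) - v x₀ - compensator s κ g y with hD
  have hDm : AEStronglyMeasurable D volume :=
    ((hv.comp_quasiMeasurePreserving
      (quasiMeasurePreserving_add_left volume x₀)).sub aestronglyMeasurable_const).sub
      (measurable_compensator s κ g).aestronglyMeasurable
  have hKm := hK.aemeasurable.aestronglyMeasurable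
  have hDK : Integrable fun y => D y * K y := by
    rw [← integrableOn_univ, ← union_compl_self (ball (0 : Rd d) ε), integrableOn_union]
    constructor
    · refine Integrable.mono' ((hK.integral_ball_le hLam hp0 hp hε).1.const_mul c₁)
        (hDm.mul hKm).restrict ?_
      rw [ae_restrict_iff' measurableSet_ball]
      refine Filter.Eventually.of_forall fun y hy => ?_
      rw [norm_mul, Real.norm_of_nonneg (hK.nonneg y), ← mul_assoc]
      exact mul_le_mul_of_nonneg_right (hin y (by simpa using hy)) (hK.nonneg y)
    · refine Integrable.mono' ((hK.integral_compl_ball_le hLam hq0 hq hε).1.const_mul c₂)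
        (hDm.mul hKm).restrict ?_
      rw [ae_restrict_iff' measurableSet_ball.compl]
      filter_upwards [hout] with y h hy
      rw [norm_mul, Real.norm_of_nonneg (hK.nonneg y), ← mul_assoc]
      exact mul_le_mul_of_nonneg_right (h (by simpa using hy)) (hK.nonneg y)
  have hlin : linOp s K v x₀ = ∫ y, D y * K y := by
    have hc := hK.integral_compensator_sub m g
    rw [← hκ] at hc
    calc linOp s K v x₀
        = ∫ y, (D y * K y + (compensator s κ g y - compensator s 1 g y) * K y) := by
          unfold linOp
          congr 1
          ext y
          rw [delta_eq]
          simp only [hD, ← hg]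
          ring
      _ = _ := by rw [integral_add hDK hc.1, hc.2, add_zero]
  obtain ⟨hi₁, hb₁⟩ := hK.integral_ball_le hLam hp0 hp hκ0
  obtain ⟨hi₂, hb₂⟩ := hK.integral_compl_ball_le hLam hq0 hq hκ0
  obtain ⟨hi₃, hb₃⟩ := hK.integral_compl_ball_le hLam hs.le (by linarith : s < 2 * s) hκ0
  obtain ⟨hi₄, hb₄⟩ := hK.mul_volume_le_setIntegral hs hlam hLam hε hρ hG hGε hGκ
  have hI₁ := (integrable_indicator_iff measurableSet_ball).mpr (hi₁.const_mul a₁)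
  have hi₂₃ : IntegrableOn (fun y : Rd d => a₂ * (‖y‖ ^ q * K y) + a₃ * (‖y‖ ^ s * K y))
      (ball 0 κ)ᶜ := (hi₂.const_mul a₂).add (hi₃.const_mul a₃)
  have hI₂ := (integrable_indicator_iff measurableSet_ball.compl).mpr hi₂₃
  have hI₄ := (IntegrableOn.integrable_indicator₀ (hi₄.const_mul b) hG)
  have hI₁₂ := hI₁.add hI₂
  simp only [Pi.add_def] at hI₁₂
  rw [hlin]
  calc ∫ y, D y * K y
      ≤ ∫ y, ((ball (0 : Rd d) κ).indicator (fun y => a₁ * (‖y‖ ^ p * K y)) y +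
          (ball 0 κ)ᶜ.indicator
            (fun y => a₂ * (‖y‖ ^ q * K y) + a₃ * (‖y‖ ^ s * K y)) y -
          G.indicator (fun y => b * K y) y) := by
        refine integral_mono_ae hDK ((hI₁.add hI₂).sub hI₄) ?_
        filter_upwards [hnear, hfar] with y h1 h2
        have hGi : G.indicator (fun y => b * K y) y = G.indicator (fun _ => b) y * K y := by
          by_cases h : y ∈ G <;> simp [h]
        rw [hGi]
        by_cases hy : ‖y‖ < κ
        · have hm : y ∈ ball (0 : Rd d) κ := by simpa using hy
          have hm' : y ∉ (ball (0 : Rd d) κ)ᶜ := fun h => h hm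
          rw [indicator_of_mem hm, indicator_of_notMem hm', add_zero, ← mul_assoc, ← sub_mul]
          exact mul_le_mul_of_nonneg_right (h1 hy) (hK.nonneg y)
        · have hm : y ∉ ball (0 : Rd d) κ := by simpa using hy
          have hm' : y ∈ (ball (0 : Rd d) κ)ᶜ := hm
          rw [indicator_of_notMem hm, indicator_of_mem hm', zero_add, ← mul_assoc,
            ← mul_assoc, ← add_mul, ← sub_mul]
          exact mul_le_mul_of_nonneg_right (h2 (not_lt.mp hy)) (hK.nonneg y)
    _ = a₁ * (∫ y in ball 0 κ, ‖y‖ ^ p * K y) +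
          (a₂ * (∫ y in (ball 0 κ)ᶜ, ‖y‖ ^ q * K y) + a₃ * ∫ y in (ball 0 κ)ᶜ, ‖y‖ ^ s * K y) -
          b * ∫ y in G, K y := by
        rw [integral_sub hI₁₂ hI₄, integral_add hI₁ hI₂,
          integral_indicator measurableSet_ball, integral_indicator measurableSet_ball.compl,
          integral_indicator₀ hG]
        rw [integral_add (hi₂.const_mul a₂) (hi₃.const_mul a₃)]
        simp only [integral_const_mul]
    _ ≤ _ := by gcongr

/-! ### Paraboloids as test functions and bounds on the compensator. -/

theorem hasGradientAt_quadratic {d : ℕ} (c B : ℝ) (x₁ x : Rd d) :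
    HasGradientAt (fun x => c + B * ‖x - x₁‖ ^ 2) ((2 * B) • (x - x₁)) x := by
  rw [hasGradientAt_iff_hasFDerivAt]
  have h := ((((hasFDerivAt_id x).sub_const x₁).norm_sq).const_mul B).const_add c
  refine h.congr_fderiv ?_
  ext y
  simp
  ring

theorem isC11OnBall_quadratic {d : ℕ} (c B : ℝ) (x₁ x₀ : Rd d) (ε : ℝ) :
    IsC11OnBall (fun x => c + B * ‖x - x₁‖ ^ 2) x₀ ε := by
  refine ⟨fun x _ => (hasGradientAt_quadratic c B x₁ x).differentiableAt.differentiableWithinAt,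
    ‖2 * B‖₊, LipschitzWith.lipschitzOnWith ?_⟩
  have : gradient (fun x : Rd d => c + B * ‖x - x₁‖ ^ 2) = fun x => (2 * B) • (x - x₁) := by
    ext1 x
    exact (hasGradientAt_quadratic c B x₁ x).gradient
  rw [this]
  refine LipschitzWith.of_dist_le_mul fun x y => ?_
  rw [dist_eq_norm, dist_eq_norm, ← smul_sub, norm_smul]
  simp

theorem glue_of_mem {d : ℕ} {x₀ x : Rd d} {ε : ℝ} (φ u : Rd d → ℝ) (h : x ∈ ball x₀ ε) :
    glue x₀ ε φ u x = φ x := by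
  classical
  exact Set.piecewise_eq_of_mem _ _ _ h

theorem glue_of_notMem {d : ℕ} {x₀ x : Rd d} {ε : ℝ} (φ u : Rd d → ℝ) (h : x ∉ ball x₀ ε) :
    glue x₀ ε φ u x = u x := by
  classical
  exact Set.piecewise_eq_of_notMem _ _ _ h

theorem gradient_glue {d : ℕ} {x₀ : Rd d} {ε : ℝ} (hε : 0 < ε) (φ u : Rd d → ℝ) :
    gradient (glue x₀ ε φ u) x₀ = gradient φ x₀ := by
  have h : glue x₀ ε φ u =ᶠ[nhds x₀] φ := by
    filter_upwards [ball_mem_nhds x₀ hε] with x hx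
    exact glue_of_mem φ u hx
  simp only [gradient, h.fderiv_eq]

theorem aestronglyMeasurable_glue {d : ℕ} {x₀ : Rd d} {ε : ℝ} {φ u : Rd d → ℝ}
    (hφ : AEStronglyMeasurable φ volume) (hu : AEStronglyMeasurable u volume) :
    AEStronglyMeasurable (glue x₀ ε φ u) volume := by
  classical
  exact AEStronglyMeasurable.piecewise measurableSet_ball hφ.restrict hu.restrict

/-- Exponent controlling the difference operator near the origin. -/
def nearExp (s : ℝ) : ℝ := if s < 1 / 2 then 1 else 2

/-- Exponent controlling the difference operator far from the origin. -/
def farExp (s : ℝ) : ℝ := if s ≤ 1 / 2 then 0 else 1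

theorem nearExp_pos (s : ℝ) : 0 < nearExp s := by unfold nearExp; split_ifs <;> norm_num

theorem two_mul_lt_nearExp {s : ℝ} (hs : s < 1) : 2 * s < nearExp s := by
  unfold nearExp; split_ifs <;> linarith

theorem farExp_nonneg (s : ℝ) : 0 ≤ farExp s := by unfold farExp; split_ifs <;> norm_num

theorem farExp_lt_two_mul {s : ℝ} (hs : 0 < s) : farExp s < 2 * s := by
  unfold farExp; split_ifs <;> linarith

theorem abs_compensator_le {d : ℕ} (s κ : ℝ) (g y : Rd d) :
    |compensator s κ g y| ≤ ‖g‖ * ‖y‖ := by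
  have h := abs_real_inner_le_norm g y
  have h0 : 0 ≤ ‖g‖ * ‖y‖ := by positivity
  unfold compensator
  split_ifs <;> simp_all

theorem abs_compensator_le_farExp {d : ℕ} (s : ℝ) {κ : ℝ} (hκ : 0 < κ) (g y : Rd d) :
    |compensator s κ g y| ≤ ‖g‖ * κ * (‖y‖ / κ) ^ farExp s := by
  by_cases hs : s ≤ 1 / 2
  · rw [farExp, if_pos hs, Real.rpow_zero, mul_one]
    unfold compensator
    split_ifs with h1 h2 h3
    · simp only [abs_zero]; positivity
    · exact (abs_real_inner_le_norm g y).trans (mul_le_mul_of_nonneg_left h3.le (norm_nonneg g))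
    · simp only [abs_zero]; positivity
    · exact absurd (le_antisymm hs (not_lt.mp h1)) h2
  · rw [farExp, if_neg hs, Real.rpow_one, mul_assoc, mul_div_cancel₀ _ hκ.ne']
    exact abs_compensator_le s κ g y

/-- Near the origin the compensated increment of a paraboloid is of order `nearExp s`. -/
theorem quadratic_sub_compensator_le {d : ℕ} {s κ B : ℝ} (hκ : 0 < κ) (hB : 0 ≤ B)
    {g y : Rd d} (hg : ‖g‖ ≤ 4 * κ * B) (hy : ‖y‖ < κ) :
    |B * ‖y‖ ^ 2 + inner ℝ g y - compensator s κ g y| ≤ 5 * (B * κ ^ 2) * (‖y‖ / κ) ^ nearExp s := by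
  have h := abs_real_inner_le_norm g y
  have hy0 := norm_nonneg y
  have ht : ‖y‖ = κ * (‖y‖ / κ) := by field_simp
  set t := ‖y‖ / κ with htdef
  have ht0 : 0 ≤ t := by positivity
  have ht1 : t ≤ 1 := by rw [htdef, div_le_one hκ]; exact hy.le
  by_cases hs : s < 1 / 2
  · rw [nearExp, if_pos hs, Real.rpow_one, compensator, if_pos hs, sub_zero]
    refine (abs_add_le _ _).trans ?_
    rw [abs_of_nonneg (by positivity)]
    have h2 : ‖g‖ * ‖y‖ ≤ 4 * κ * B * ‖y‖ := mul_le_mul_of_nonneg_right hg hy0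
    have h3 : B * κ ^ 2 * t ^ 2 ≤ B * κ ^ 2 * t :=
      mul_le_mul_of_nonneg_left (by nlinarith) (by positivity)
    rw [ht] at h h2 ⊢
    nlinarith
  · have e : compensator s κ g y = inner ℝ g y := by
      rw [compensator, if_neg hs]
      simp [hy]
    rw [nearExp, if_neg hs, e, add_sub_cancel_right, abs_of_nonneg (by positivity), Real.rpow_two]
    rw [ht]
    have : 0 ≤ B * κ ^ 2 * t ^ 2 := by positivity
    nlinarith

/-- Bernoulli's inequality for `t ^ s` with exponent `α / s ≤ 1`. The factor `α` is what makes the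
tail error small. -/
theorem rpow_sub_one_le {t α s : ℝ} (ht : 1 ≤ t) (hα : 0 ≤ α) (hs : 0 < s) (hαs : α ≤ s) :
    t ^ α - 1 ≤ α / s * t ^ s := by
  have h0 : 0 ≤ t := by linarith
  have h1 : 1 ≤ t ^ s := Real.one_le_rpow ht hs.le
  have h := rpow_one_add_le_one_add_mul_self (s := t ^ s - 1) (p := α / s) (by linarith)
    (by positivity) (by rw [div_le_one hs]; exact hαs)
  rw [add_sub_cancel, ← Real.rpow_mul h0, mul_div_cancel₀ _ hs.ne'] at h
  have : 0 ≤ α / s := by positivity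
  nlinarith

/-! ### The growth lemma. -/

/-- Testing from above at points of `Ω`: every test function satisfies
`-A ≤ sup_K L_K v + D |∇ v|`. -/
def IsTestedSub {d : ℕ} (s lam Lam ρ D A : ℝ) (Ω : Set (Rd d)) (u : Rd d → ℝ) : Prop :=
  ∀ x₀ ∈ Ω, ∀ ε : ℝ, 0 < ε → ball x₀ ε ⊆ Ω →
    ∀ φ : Rd d → ℝ, IsC11OnBall φ x₀ ε → u x₀ = φ x₀ → (∀ x ∈ ball x₀ ε, u x ≤ φ x) →
      ∀ b : ℝ, (∀ K, IsAdmissibleKernel d s lam Lam ρ K → linOp s K (glue x₀ ε φ u) x₀ ≤ b) →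
        -A ≤ b + D * ‖gradient (glue x₀ ε φ u) x₀‖

/-- The gain constant in the growth lemma. -/
def gainConst (d : ℕ) (s lam : ℝ) : ℝ :=
  lam * 8 ^ (-(d : ℝ) - 2 * s) * volume.real (ball (0 : Rd d) 1) / 8

theorem gainConst_pos (d : ℕ) {s lam : ℝ} (hlam : 0 < lam) : 0 < gainConst d s lam := by
  have : 0 < volume.real (ball (0 : Rd d) 1) :=
    ENNReal.toReal_pos (measure_ball_pos volume _ one_pos).ne' measure_ball_lt_top.ne
  unfold gainConst
  positivity

theorem volume_real_ball {d : ℕ} (x : Rd d) {r : ℝ} (hr : 0 < r) :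
    volume.real (ball x r) = r ^ d * volume.real (ball (0 : Rd d) 1) := by
  rw [Measure.real, Measure.addHaar_ball_of_pos _ _ hr, ENNReal.toReal_mul,
    ENNReal.toReal_ofReal (by positivity), finrank_euclideanSpace_fin, Measure.real]

/-- Lower bound for the measure of the set where the gain takes place. -/
theorem volume_real_gain_ge {d : ℕ} (hd : 1 ≤ d) {S : Set (Rd d)} {x₀ z : Rd d} {κ ε : ℝ}
    (hκ : 0 < κ) (hε : 0 < ε) (hεκ : ε ≤ κ / 4) (hS : S ⊆ ball z κ)
    (hhalf : volume (ball z κ) ≤ 2 * volume S) :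
    κ ^ d * volume.real (ball (0 : Rd d) 1) / 4 ≤
      volume.real ({y | x₀ + y ∈ S} \ ball 0 ε) := by
  have hS' : volume S ≠ ∞ := ((measure_mono hS).trans_lt measure_ball_lt_top).ne
  have e : volume {y | x₀ + y ∈ S} = volume S := measure_preimage_add volume x₀ S
  have h1 : volume.real S ≤ volume.real ({y | x₀ + y ∈ S} \ ball 0 ε) +
      volume.real (ball (0 : Rd d) ε) := by
    have := measureReal_union_le (μ := volume) ({y | x₀ + y ∈ S} \ ball 0 ε) (ball (0 : Rd d) ε)
    refine le_trans ?_ this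
    rw [← show volume.real {y | x₀ + y ∈ S} = volume.real S by simp only [Measure.real, e]]
    refine measureReal_mono ?_ ?_
    · rw [sdiff_union_self]; exact subset_union_left
    · rw [sdiff_union_self]
      exact (measure_union_lt_top (by rw [e]; exact hS'.lt_top) measure_ball_lt_top).ne
  have h2 : volume.real (ball z κ) ≤ 2 * volume.real S := by
    have := ENNReal.toReal_mono (ENNReal.mul_ne_top ENNReal.ofNat_ne_top hS') hhalf
    simpa [Measure.real] using this
  rw [volume_real_ball _ hκ] at h2
  rw [volume_real_ball _ hε] at h1
  have hω : 0 ≤ volume.real (ball (0 : Rd d) 1) := measureReal_nonneg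
  -- Since `d ≥ 1`, the removed ball has at most a quarter of the volume, so at least a half minus a
  -- quarter remains.
  have h3 : ε ^ d ≤ κ ^ d / 4 := by
    calc ε ^ d ≤ (κ / 4) ^ d := pow_le_pow_left₀ hε.le hεκ d
      _ = κ ^ d * (1 / 4) ^ d := by rw [← mul_pow]; ring_nf
      _ ≤ κ ^ d * (1 / 4) ^ 1 := by
        gcongr ?_ * ?_
        exact pow_le_pow_of_le_one (by norm_num) (by norm_num) hd
      _ = κ ^ d / 4 := by ring
  nlinarith

theorem ae_abs_le_supNorm {d : ℕ} {u : Rd d → ℝ} (hu : MemLp u ∞ volume) :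
    ∀ᵐ x, |u x| ≤ supNorm u := by
  filter_upwards [ae_le_eLpNormEssSup (f := u) (μ := volume)] with x hx
  rw [← eLpNorm_exponent_top] at hx
  have := ENNReal.toReal_mono hu.2.ne hx
  simpa [supNorm] using this

/-- A paraboloid centred at `x₁` touches `u` from above close to `x₁`. -/
theorem exists_touching_paraboloid {d : ℕ} {u : Rd d → ℝ} {z x₁ : Rd d} {κ h θ c₀ B : ℝ}
    (hκ : 0 < κ) (hB : B * (4 * κ ^ 2) = θ * h) (hu : UpperSemicontinuousOn u (ball z (4 * κ)))
    (hx₁ : x₁ ∈ ball z κ) (hle : ∀ x ∈ ball z (4 * κ), u x ≤ c₀ + h) (hB0 : 0 ≤ B)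
    (hbig : c₀ + h * (1 - θ) < u x₁) :
    ∃ x₀, ‖x₀ - x₁‖ < 2 * κ ∧ c₀ + h * (1 - θ) < u x₀ - B * ‖x₀ - x₁‖ ^ 2 ∧
      ∀ x ∈ ball z (4 * κ), u x ≤ u x₀ - B * ‖x₀ - x₁‖ ^ 2 + B * ‖x - x₁‖ ^ 2 := by
  have hsub : closedBall x₁ (2 * κ) ⊆ ball z (4 * κ) := by
    refine closedBall_subset_ball' ?_
    have := mem_ball.mp hx₁
    linarith
  have husc : UpperSemicontinuousOn (fun x => u x + -(B * ‖x - x₁‖ ^ 2)) (closedBall x₁ (2 * κ)) := by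
    refine (hu.mono hsub).add (ContinuousOn.upperSemicontinuousOn ?_)
    fun_prop
  obtain ⟨x₀, hx₀, hmax⟩ := husc.exists_isMaxOn
    ⟨x₁, mem_closedBall_self (by positivity)⟩ (isCompact_closedBall x₁ (2 * κ))
  have hmax1 := hmax (mem_closedBall_self (x := x₁) (by positivity : 0 ≤ 2 * κ))
  simp only [mem_ofPred_eq, sub_self, norm_zero] at hmax1
  have hlow : c₀ + h * (1 - θ) < u x₀ - B * ‖x₀ - x₁‖ ^ 2 := by linarith
  -- By the choice of `B`, at distance `2κ` or more the penalty is at least `θh`, which brings `u`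
  -- minus the penalty below its value at `x₁`. The maximum is therefore interior, and the
  -- paraboloid dominates `u` in the whole large ball.
  have hout : ∀ x, 2 * κ ≤ ‖x - x₁‖ → θ * h ≤ B * ‖x - x₁‖ ^ 2 := by
    intro x hx
    rw [← hB]
    refine mul_le_mul_of_nonneg_left ?_ hB0
    nlinarith
  refine ⟨x₀, ?_, hlow, fun x hx => ?_⟩
  · by_contra hcon
    have h1 := hout x₀ (not_lt.mp hcon)
    have h2 := hle x₀ (hsub hx₀)
    linarith
  · by_cases hx' : x ∈ closedBall x₁ (2 * κ)
    · have := hmax hx'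
      simp only [mem_ofPred_eq] at this
      linarith
    · rw [mem_closedBall, dist_eq_norm, not_le] at hx'
      have h1 := hout x hx'.le
      have h2 := hle x hx
      linarith

-- By contradiction: a paraboloid touches `u` at `x₀`, and the test function built from it violates
-- the equation, the gain from the half ball outweighing all errors. Every term is a multiple of `h
-- * κ ^ (-2s)`, so the smallness conditions do not depend on the scale.
set_option maxHeartbeats 1000000 in
theorem growth_lemma {d : ℕ} (hd : 1 ≤ d) {s lam Lam ρ D D₀ A : ℝ} (hs0 : 0 < s) (hs1 : s < 1)
    (hlam : 0 < lam) (hLam : 0 < Lam) {κ θ α : ℝ} {m : ℤ} (hκm : κ = 2 ^ m) (hρ : ρ ≤ 8 * κ)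
    (hD : 0 ≤ D) (hD₀ : D * κ ^ (2 * s - 1) ≤ D₀) (hθ0 : 0 < θ) (hθ1 : θ ≤ 1 / 4) (hα0 : 0 ≤ α) (hαs : α ≤ s)
    (hθ : θ * (2 * momentConst s (nearExp s) * Lam + 2 * momentConst s (farExp s) * Lam + D₀) ≤
      gainConst d s lam / 4)
    (hα : α * (8 / s * (momentConst s s * Lam)) ≤ gainConst d s lam / 4)
    {u : Rd d → ℝ} (hu : MemLp u ∞ volume) {z : Rd d}
    (husc : UpperSemicontinuousOn u (ball z (4 * κ)))
    (htest : IsTestedSub s lam Lam ρ D A (ball z (4 * κ)) u) {c₀ h : ℝ} (hh : 0 < h)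
    (hle : ∀ x ∈ ball z (4 * κ), u x ≤ c₀ + h)
    (htail : ∀ᵐ x, 4 * κ ≤ ‖x - z‖ → u x ≤ c₀ + h * (2 * (‖x - z‖ / κ) ^ α - 1))
    (hhalf : volume (ball z κ) ≤ 2 * volume ({x | u x ≤ c₀} ∩ ball z κ))
    (hA : A ≤ gainConst d s lam / 4 * (h * κ ^ (-(2 * s)))) :
    ∀ x ∈ ball z κ, u x ≤ c₀ + h * (1 - θ) := by
  have hκ : 0 < κ := by rw [hκm]; positivity
  intro x₁ hx₁
  by_contra! hbig
  obtain ⟨B, hB0, hB⟩ : ∃ B, 0 < B ∧ B * (4 * κ ^ 2) = θ * h :=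
    ⟨θ * h / (4 * κ ^ 2), by positivity, by field_simp⟩
  obtain ⟨x₀, hx₀, hlow, hmax⟩ := exists_touching_paraboloid hκ hB husc hx₁ hle hB0.le hbig
  obtain ⟨c, hc⟩ : ∃ c, c = u x₀ - B * ‖x₀ - x₁‖ ^ 2 := ⟨_, rfl⟩
  rw [← hc] at hlow hmax
  have hux₀ : c₀ + h * (1 - θ) < u x₀ := by
    have : 0 ≤ B * ‖x₀ - x₁‖ ^ 2 := by positivity
    linarith
  have hx₁z : ‖x₁ - z‖ < κ := by rwa [mem_ball, dist_eq_norm] at hx₁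
  have hx₀z : ‖x₀ - z‖ < 3 * κ := by
    have := norm_add_le (x₀ - x₁) (x₁ - z)
    rw [sub_add_sub_cancel] at this
    linarith
  set ε := κ / 4 with hεdef
  have hε : 0 < ε := by positivity
  have hball : ball x₀ ε ⊆ ball z (4 * κ) := by
    refine ball_subset_ball' ?_
    rw [dist_eq_norm]
    linarith
  set φ : Rd d → ℝ := fun x => c + B * ‖x - x₁‖ ^ 2 with hφ
  set v := glue x₀ ε φ u with hv
  set g : Rd d := (2 * B) • (x₀ - x₁) with hg
  have hgrad : gradient v x₀ = g := by
    rw [hv, gradient_glue hε]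
    exact (hasGradientAt_quadratic c B x₁ x₀).gradient
  have hgn : ‖g‖ ≤ 4 * κ * B := by
    rw [hg, norm_smul, Real.norm_of_nonneg (by positivity)]
    calc 2 * B * ‖x₀ - x₁‖ ≤ 2 * B * (2 * κ) := by gcongr
      _ = 4 * κ * B := by ring
  have hgκ : ‖g‖ * κ ≤ θ * h := by
    calc ‖g‖ * κ ≤ 4 * κ * B * κ := by gcongr
      _ = θ * h := by rw [← hB]; ring
  have hθh : θ * h ≤ h / 4 := by
    calc θ * h ≤ 1 / 4 * h := by gcongr
      _ = h / 4 := by ring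
  have hφx : ∀ y, φ (x₀ + y) = u x₀ + B * ‖y‖ ^ 2 + inner ℝ g y := by
    intro y
    have e : x₀ + y - x₁ = (x₀ - x₁) + y := by abel
    simp only [hφ, hc, hg]
    rw [e, norm_add_sq_real, inner_smul_left]
    simp
    ring
  have hvx₀ : v x₀ = u x₀ := by
    rw [hv, glue_of_mem _ _ (mem_ball_self hε)]
    simp [hφ, hc]
  have hvin : ∀ y, ‖y‖ < ε → v (x₀ + y) = φ (x₀ + y) := fun y hy =>
    glue_of_mem _ _ (by simpa using hy)
  have hvout : ∀ y, ε ≤ ‖y‖ → v (x₀ + y) = u (x₀ + y) := fun y hy =>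
    glue_of_notMem _ _ (by simpa using hy)
  have hvle : ∀ y, ‖y‖ < κ → v (x₀ + y) ≤ φ (x₀ + y) := by
    intro y hy
    by_cases hyε : ‖y‖ < ε
    · exact (hvin y hyε).le
    · rw [hvout y (not_lt.mp hyε)]
      refine hmax _ ?_
      rw [mem_ball, dist_eq_norm, add_sub_right_comm]
      have := norm_add_le (x₀ - z) y
      linarith
  have hcompfar : ∀ y, |compensator s κ g y| ≤ θ * h * (‖y‖ / κ) ^ farExp s := fun y =>
    (abs_compensator_le_farExp s hκ g y).trans
      (mul_le_mul_of_nonneg_right hgκ (by positivity))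
  -- The ball of radius `ε` is removed because there `v` is the paraboloid and not `u`.
  set G : Set (Rd d) := {y | x₀ + y ∈ {x | u x ≤ c₀} ∩ ball z κ} \ ball 0 ε with hG
  have hGm : NullMeasurableSet G := by
    have h1 : NullMeasurableSet ({x | u x ≤ c₀} ∩ ball z κ) :=
      (nullMeasurableSet_le hu.1.aemeasurable aemeasurable_const).inter
        measurableSet_ball.nullMeasurableSet
    exact (h1.preimage (quasiMeasurePreserving_add_left volume x₀)).diff
      measurableSet_ball.nullMeasurableSet
  have hGε : ∀ y ∈ G, ε ≤ ‖y‖ := fun y hy => by simpa using hy.2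
  have hGκ : ∀ y ∈ G, ‖y‖ ≤ 8 * κ := by
    intro y hy
    have h1 : ‖x₀ + y - z‖ < κ := by simpa [dist_eq_norm] using hy.1.2
    have h2 := norm_sub_le (x₀ + y - z) (x₀ - z)
    rw [show x₀ + y - z - (x₀ - z) = y by abel] at h2
    linarith
  have hGv : ∀ y ∈ G, v (x₀ + y) - v x₀ ≤ -(h * (1 - θ)) := by
    intro y hy
    rw [hvout y (hGε y hy), hvx₀]
    have : u (x₀ + y) ≤ c₀ := hy.1.1
    linarith
  have hGvol := volume_real_gain_ge hd (x₀ := x₀) hκ hε le_rfl inter_subset_right hhalf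
  rw [← hG] at hGvol
  have hb0 : 0 ≤ gainConst d s lam := (gainConst_pos d hlam).le
  -- On `G` the increment is at most `-(1 - θ)h` and the compensator costs at most `θh`; `θ ≤ 1/4`
  -- leaves `-h/2`. Off `G` the constant is `5Bκ² = 5θh/4 ≤ 2θh`.
  have hnear : ∀ y, ‖y‖ < κ → v (x₀ + y) - v x₀ - compensator s κ (gradient v x₀) y ≤
      2 * (θ * h) / κ ^ nearExp s * ‖y‖ ^ nearExp s - G.indicator (fun _ => h / 2) y := by
    intro y hy
    rw [hgrad, div_mul_eq_mul_div, mul_div_assoc, ← Real.div_rpow (norm_nonneg y) hκ.le]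
    have ht : 0 ≤ (‖y‖ / κ) ^ nearExp s := by positivity
    have hth : 0 < θ * h := by positivity
    by_cases hyG : y ∈ G
    · rw [indicator_of_mem hyG]
      have h1 := hGv y hyG
      have h2 := abs_compensator_le s κ g y
      have h3 : ‖g‖ * ‖y‖ ≤ θ * h := (mul_le_mul_of_nonneg_left hy.le (norm_nonneg g)).trans hgκ
      have h4 := neg_abs_le (compensator s κ g y)
      linarith [mul_nonneg hth.le ht]
    · rw [indicator_of_notMem hyG, sub_zero]
      have h1 := quadratic_sub_compensator_le (s := s) hκ hB0.le hgn hy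
      have h2 := hvle y hy
      rw [hφx] at h2
      rw [hvx₀]
      have h3 := le_abs_self (B * ‖y‖ ^ 2 + inner ℝ g y - compensator s κ g y)
      have h4 : 5 * (B * κ ^ 2) ≤ 2 * (θ * h) := by linarith
      have h5 := mul_le_mul_of_nonneg_right h4 ht
      linarith
  have hfar : ∀ᵐ y, κ ≤ ‖y‖ → v (x₀ + y) - v x₀ - compensator s κ (gradient v x₀) y ≤
      2 * (θ * h) / κ ^ farExp s * ‖y‖ ^ farExp s + 8 * (α / s) * h / κ ^ s * ‖y‖ ^ s -
        G.indicator (fun _ => h / 2) y := by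
    filter_upwards [(quasiMeasurePreserving_add_left volume x₀).ae htail] with y hty hy
    rw [hgrad, div_mul_eq_mul_div, mul_div_assoc, ← Real.div_rpow (norm_nonneg y) hκ.le,
      div_mul_eq_mul_div, mul_div_assoc, ← Real.div_rpow (norm_nonneg y) hκ.le]
    have hth : 0 < θ * h := by positivity
    have ht1 : 1 ≤ ‖y‖ / κ := by rwa [one_le_div hκ]
    have ht : 1 ≤ (‖y‖ / κ) ^ farExp s := Real.one_le_rpow ht1 (farExp_nonneg s)
    have h2 := (neg_abs_le (compensator s κ g y)).trans' (neg_le_neg (hcompfar y))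
    have hαs0 : 0 ≤ 8 * (α / s) * h * (‖y‖ / κ) ^ s := by positivity
    have h6 := mul_le_mul_of_nonneg_left ht hth.le
    have hyε : ε ≤ ‖y‖ := by linarith
    by_cases hyG : y ∈ G
    · rw [indicator_of_mem hyG]
      have h1 := hGv y hyG
      linarith
    · rw [indicator_of_notMem hyG, sub_zero, hvx₀, hvout y hyε]
      by_cases hyz : ‖x₀ + y - z‖ < 4 * κ
      · have h1 := hle (x₀ + y) (by rwa [mem_ball, dist_eq_norm])
        linarith
      · rw [not_lt] at hyz
        have h1 := hty hyz
        -- Because `‖x₀ - z‖ < 3κ ≤ 3‖y‖`.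
        have h3 : ‖x₀ + y - z‖ / κ ≤ 4 * (‖y‖ / κ) := by
          rw [← mul_div_assoc]
          gcongr
          have := norm_add_le (x₀ - z) y
          rw [show x₀ - z + y = x₀ + y - z by abel] at this
          linarith
        have h4 := Real.rpow_le_rpow (by positivity) h3 hα0
        have h5 := rpow_sub_one_le (by linarith : 1 ≤ 4 * (‖y‖ / κ)) hα0 hs0 hαs
        have h7 : (4 * (‖y‖ / κ)) ^ s ≤ 4 * (‖y‖ / κ) ^ s := by
          rw [Real.mul_rpow (by norm_num) (by positivity)]
          gcongr
          calc (4 : ℝ) ^ s ≤ 4 ^ (1 : ℝ) := Real.rpow_le_rpow_of_exponent_le (by norm_num) hs1.le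
            _ = 4 := Real.rpow_one 4
        have h8 : α / s * (4 * (‖y‖ / κ)) ^ s ≤ α / s * (4 * (‖y‖ / κ) ^ s) :=
          mul_le_mul_of_nonneg_left h7 (by positivity)
        have h9 : h * ((‖x₀ + y - z‖ / κ) ^ α - 1) ≤ h * (α / s * (4 * (‖y‖ / κ) ^ s)) :=
          mul_le_mul_of_nonneg_left (by linarith) hh.le
        linarith
  have hin : ∀ y, ‖y‖ < ε → |v (x₀ + y) - v x₀ - compensator s κ (gradient v x₀) y| ≤
      5 * (B * κ ^ 2) / κ ^ nearExp s * ‖y‖ ^ nearExp s := by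
    intro y hy
    rw [hgrad, hvx₀, hvin y hy, hφx, div_mul_eq_mul_div, mul_div_assoc,
      ← Real.div_rpow (norm_nonneg y) hκ.le]
    have := quadratic_sub_compensator_le (s := s) hκ hB0.le hgn (by linarith : ‖y‖ < κ)
    convert this using 2
    ring
  have hout : ∀ᵐ y, ε ≤ ‖y‖ → |v (x₀ + y) - v x₀ - compensator s κ (gradient v x₀) y| ≤
      ((supNorm u + |u x₀|) / ε ^ farExp s + θ * h / κ ^ farExp s) * ‖y‖ ^ farExp s := by
    filter_upwards [(quasiMeasurePreserving_add_left volume x₀).ae (ae_abs_le_supNorm hu)] with y hy hyε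
    rw [hgrad, hvx₀, hvout y hyε, add_mul, div_mul_eq_mul_div, mul_div_assoc,
      ← Real.div_rpow (norm_nonneg y) hε.le, div_mul_eq_mul_div, mul_div_assoc,
      ← Real.div_rpow (norm_nonneg y) hκ.le]
    have h1 : 1 ≤ (‖y‖ / ε) ^ farExp s :=
      Real.one_le_rpow (by rwa [one_le_div hε]) (farExp_nonneg s)
    have h2 := abs_sub (u (x₀ + y) - u x₀) (compensator s κ g y)
    have h3 := abs_sub (u (x₀ + y)) (u x₀)
    have h4 : 0 ≤ supNorm u := ENNReal.toReal_nonneg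
    have h5 := hcompfar y
    have h6 := mul_le_mul_of_nonneg_left h1 (add_nonneg h4 (abs_nonneg (u x₀)))
    linarith
  have key : ∀ K, IsAdmissibleKernel d s lam Lam ρ K → linOp s K v x₀ ≤
      (θ * (2 * momentConst s (nearExp s) * Lam + 2 * momentConst s (farExp s) * Lam) +
        α * (8 / s * (momentConst s s * Lam)) - gainConst d s lam) * (h * κ ^ (-(2 * s))) := by
    intro K hK
    refine (hK.linOp_le hs0 hlam hLam hκm (nearExp_pos s) (two_mul_lt_nearExp hs1)
      (farExp_nonneg s) (farExp_lt_two_mul hs0) hε (by positivity) (by positivity) (by positivity)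
      (by positivity) (aestronglyMeasurable_glue ?_ hu.1) hin hout hGm hGε hGκ hρ
      (Filter.Eventually.of_forall hnear) hfar).trans ?_
    · exact Continuous.aestronglyMeasurable (by fun_prop)
    · have e : ∀ p : ℝ, κ ^ (p - 2 * s) = κ ^ p * κ ^ (-(2 * s)) := fun p => by
        rw [← Real.rpow_add hκ, sub_eq_add_neg]
      have e2 : (8 * κ) ^ (-(d : ℝ) - 2 * s) * κ ^ d = 8 ^ (-(d : ℝ) - 2 * s) * κ ^ (-(2 * s)) := by
        rw [Real.mul_rpow (by norm_num) hκ.le, ← Real.rpow_natCast κ d, mul_assoc,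
          ← Real.rpow_add hκ]
        ring_nf
      -- The 8 in the denominator of `gainConst` is 2 from the drop `h/2` times 4 from the volume of
      -- `G`.
      have e3 : gainConst d s lam * (h * κ ^ (-(2 * s))) ≤
          h / 2 * (lam * (8 * κ) ^ (-(d : ℝ) - 2 * s) * volume.real G) := by
        calc gainConst d s lam * (h * κ ^ (-(2 * s)))
            = h / 2 * (lam * (8 * κ) ^ (-(d : ℝ) - 2 * s) *
                (κ ^ d * volume.real (ball (0 : Rd d) 1) / 4)) := by
              unfold gainConst
              linear_combination (-(h * lam * volume.real (ball (0 : Rd d) 1) / 8)) * e2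
          _ ≤ _ := by gcongr
      rw [e, e, e]
      have hp := (Real.rpow_pos_of_pos hκ (nearExp s)).ne'
      have hq := (Real.rpow_pos_of_pos hκ (farExp s)).ne'
      have hss := (Real.rpow_pos_of_pos hκ s).ne'
      have e4 : ∀ a w C : ℝ, w ≠ 0 → a / w * (C * (w * κ ^ (-(2 * s)))) = a * C * κ ^ (-(2 * s)) := by
        intro a w C hw
        field_simp
      rw [e4 _ _ _ hp, e4 _ _ _ hq, e4 _ _ _ hss]
      refine le_of_sub_nonneg ?_
      have e5 : 8 * (α / s) = α * (8 / s) := by ring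
      rw [e5]
      linarith
  have hfin := htest x₀ (hball (mem_ball_self hε)) ε hε hball φ (isC11OnBall_quadratic c B x₁ x₀ ε)
    (by simp [hφ, hc]) (fun x hx => hmax x (hball hx)) _ key
  rw [← hv, hgrad] at hfin
  have hDg : D * ‖g‖ ≤ D₀ * θ * (h * κ ^ (-(2 * s))) := by
    have h1 : ‖g‖ ≤ θ * h / κ := by rwa [le_div_iff₀ hκ]
    have h2 : D / κ = D * κ ^ (2 * s - 1) * κ ^ (-(2 * s)) := by
      rw [mul_assoc, ← Real.rpow_add hκ, show 2 * s - 1 + -(2 * s) = -1 by ring, Real.rpow_neg_one,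
        div_eq_mul_inv]
    calc D * ‖g‖ ≤ D * (θ * h / κ) := mul_le_mul_of_nonneg_left h1 hD
      _ = D / κ * (θ * h) := by ring
      _ = D * κ ^ (2 * s - 1) * (θ * h * κ ^ (-(2 * s))) := by rw [h2]; ring
      _ ≤ D₀ * (θ * h * κ ^ (-(2 * s))) := by gcongr
      _ = _ := by ring
  have hH : 0 < h * κ ^ (-(2 * s)) := by positivity
  have hg0 := gainConst_pos d (s := s) hlam
  -- With `H = h * κ ^ (-2s)` and `g` the gain: `θ` and the drift cost `gH/4`, the tail costs
  -- `gH/4`, so `-A ≤ -gH/2`, against `A ≤ gH/4`.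
  linarith [mul_le_mul_of_nonneg_right hθ hH.le, mul_le_mul_of_nonneg_right hα hH.le,
    mul_pos hg0 hH]

/-! ### Decay of oscillation. -/

theorem IsTestedSub.mono {d : ℕ} {s lam Lam ρ D A : ℝ} {Ω Ω' : Set (Rd d)} {u : Rd d → ℝ}
    (h : IsTestedSub s lam Lam ρ D A Ω u) (hsub : Ω' ⊆ Ω) :
    IsTestedSub s lam Lam ρ D A Ω' u :=
  fun x₀ hx₀ ε hε hball => h x₀ (hsub hx₀) ε hε (hball.trans hsub)

/-- The smallness conditions on the decay constant `θ` and the Hölder exponent `α`. -/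
structure IsDecayPair (d : ℕ) (s lam Lam D₀ θ α : ℝ) : Prop where
  theta_pos : 0 < θ
  theta_le : θ ≤ 1 / 4
  alpha_pos : 0 < α
  alpha_le : α ≤ s
  theta_small : θ * (2 * momentConst s (nearExp s) * Lam + 2 * momentConst s (farExp s) * Lam + D₀)
    ≤ gainConst d s lam / 4
  alpha_small : α * (8 / s * (momentConst s s * Lam)) ≤ gainConst d s lam / 4
  decay : 1 - θ / 2 ≤ 4 ^ (-α)

theorem exists_isDecayPair (d : ℕ) {s lam Lam D₀ : ℝ} (hs0 : 0 < s) (hs1 : s < 1) (hlam : 0 < lam)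
    (hLam : 0 < Lam) (hD₀ : 0 ≤ D₀) : ∃ θ α, IsDecayPair d s lam Lam D₀ θ α := by
  have hg := gainConst_pos d (s := s) hlam
  have h1 := momentConst_pos (two_mul_lt_nearExp hs1).ne'
  have h2 := momentConst_pos (farExp_lt_two_mul hs0).ne
  have h3 := momentConst_pos (s := s) (p := s) (by linarith)
  set g := gainConst d s lam
  set M := 2 * momentConst s (nearExp s) * Lam + 2 * momentConst s (farExp s) * Lam + D₀ with hM
  set M' := 8 / s * (momentConst s s * Lam) with hM'
  have hM0 : 0 < M := by positivity
  have hM0' : 0 < M' := by positivity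
  set θ := min (1 / 4) (g / 4 / M) with hθ
  have hθ0 : 0 < θ := lt_min (by norm_num) (by positivity)
  set α := min s (min (g / 4 / M') (θ / 4)) with hα
  refine ⟨θ, α, hθ0, min_le_left _ _, lt_min hs0 (lt_min (by positivity) (by positivity)),
    min_le_left _ _, ?_, ?_, ?_⟩
  · rw [← le_div_iff₀ hM0]; exact min_le_right _ _
  · rw [← le_div_iff₀ hM0']; exact (min_le_right _ _).trans (min_le_left _ _)
  -- `4 ^ (-α) ≥ 1 - α log 4 ≥ 1 - 2α ≥ 1 - θ/2`.
  · have hαθ : α ≤ θ / 4 := (min_le_right _ _).trans (min_le_right _ _)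
    have hα0 : 0 < α := lt_min hs0 (lt_min (by positivity) (by positivity))
    rw [Real.rpow_def_of_pos (by norm_num)]
    have h4 := Real.add_one_le_exp (Real.log 4 * -α)
    have h5 : Real.log 4 ≤ 2 := by
      have : (4 : ℝ) = 2 ^ 2 := by norm_num
      rw [this, Real.log_pow]
      have := Real.log_two_lt_d9
      push_cast
      linarith
    nlinarith

/-- Oscillation control of `u` around `z`: by `h` in `B_{4κ}(z)`, with Hölder growth outside. -/
def OscBound {d : ℕ} (u : Rd d → ℝ) (z : Rd d) (α κ h c : ℝ) : Prop :=
  (∀ x ∈ ball z (4 * κ), |u x - c| ≤ h) ∧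
    ∀ᵐ x, 4 * κ ≤ ‖x - z‖ → |u x - c| ≤ h * (2 * (‖x - z‖ / κ) ^ α - 1)

theorem OscBound.neg {d : ℕ} {u : Rd d → ℝ} {z : Rd d} {α κ h c : ℝ} (H : OscBound u z α κ h c) :
    OscBound (-u) z α κ h (-c) := by
  have e : ∀ x, |(-u) x - -c| = |u x - c| := fun x => by
    rw [Pi.neg_apply, sub_neg_eq_add, neg_add_eq_sub, abs_sub_comm]
  simpa only [OscBound, e] using H

/-- With `q = 4 ^ (-α)`, the new centre keeps the lower bound `c - h` exact, and the upper bound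
needs `2 - θ ≤ 2q`. The tail profile `2t^α - 1` is chosen to reproduce itself: shifting the centre
adds `h(1 - q)`, and rescaling absorbs precisely this amount. -/
theorem OscBound.improve {d : ℕ} {u : Rd d → ℝ} {z : Rd d} {α κ h c θ : ℝ}
    (H : OscBound u z α κ h c) (hκ : 0 < κ) (hh : 0 < h) (hα : 0 < α)
    (hdecay : 1 - θ / 2 ≤ 4 ^ (-α)) (hle : ∀ x ∈ ball z κ, u x ≤ c + h * (1 - θ)) :
    OscBound u z α (κ / 4) (h * 4 ^ (-α)) (c - h * (1 - 4 ^ (-α))) := by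
  set q : ℝ := 4 ^ (-α) with hq
  have hq0 : 0 < q := by positivity
  have hq1 : q ≤ 1 := Real.rpow_le_one_of_one_le_of_nonpos (by norm_num) (by linarith)
  have hq4 : q * 4 ^ α = 1 := by
    rw [hq, ← Real.rpow_add (by norm_num), neg_add_cancel, Real.rpow_zero]
  have hhq : 0 ≤ h * (1 - q) := mul_nonneg hh.le (by linarith)
  have hshift : ∀ {a b : ℝ}, |a - c| ≤ b → |a - (c - h * (1 - q))| ≤ b + h * (1 - q) := by
    intro a b hab
    rw [abs_le] at hab ⊢
    constructor <;> linarith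
  have hscale : ∀ x, h * q * (2 * (‖x - z‖ / (κ / 4)) ^ α - 1) =
      h * (2 * (‖x - z‖ / κ) ^ α) - h * q := by
    intro x
    rw [show ‖x - z‖ / (κ / 4) = 4 * (‖x - z‖ / κ) by field_simp,
      Real.mul_rpow (by norm_num) (by positivity)]
    linear_combination (2 * h * (‖x - z‖ / κ) ^ α) * hq4
  constructor
  · intro x hx
    rw [mul_div_cancel₀ _ (by norm_num : (4 : ℝ) ≠ 0)] at hx
    have h1 := hle x hx
    have h2 := H.1 x (ball_subset_ball (by linarith) hx)
    rw [abs_le] at h2 ⊢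
    have h3 : h * (1 - θ / 2) ≤ h * q := mul_le_mul_of_nonneg_left hdecay hh.le
    constructor <;> linarith
  · filter_upwards [H.2] with x hx hxκ
    rw [hscale]
    by_cases h1 : 4 * κ ≤ ‖x - z‖
    · have := hshift (hx h1)
      linarith
    · have h2 := hshift (H.1 x (by rw [mem_ball, dist_eq_norm]; linarith))
      have h3 : 1 ≤ (‖x - z‖ / κ) ^ α :=
        Real.one_le_rpow (by rw [one_le_div hκ]; linarith) hα.le
      have h4 := mul_le_mul_of_nonneg_left h3 hh.le
      linarith

/-- One of `{u ≤ c₀}`, `{u ≥ c₀}` fills half of the small ball, so the growth lemma applies to `u`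
or to `-u`. -/
theorem OscBound.step {d : ℕ} (hd : 1 ≤ d) {s lam Lam ρ D D₀ A : ℝ} (hs0 : 0 < s) (hs1 : s < 1)
    (hlam : 0 < lam) (hLam : 0 < Lam) {κ θ α : ℝ} {m : ℤ} (hκm : κ = 2 ^ m) (hρ : ρ ≤ 8 * κ)
    (hD : 0 ≤ D) (hD₀ : D * κ ^ (2 * s - 1) ≤ D₀) (P : IsDecayPair d s lam Lam D₀ θ α)
    {u : Rd d → ℝ} (hu : MemLp u ∞ volume) {z : Rd d}
    (husc : UpperSemicontinuousOn u (ball z (4 * κ)))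
    (husc' : UpperSemicontinuousOn (-u) (ball z (4 * κ)))
    (htest : IsTestedSub s lam Lam ρ D A (ball z (4 * κ)) u)
    (htest' : IsTestedSub s lam Lam ρ D A (ball z (4 * κ)) (-u)) {c₀ h : ℝ} (hh : 0 < h)
    (hA : A ≤ gainConst d s lam / 4 * (h * κ ^ (-(2 * s)))) (H : OscBound u z α κ h c₀) :
    ∃ c, OscBound u z α (κ / 4) (h * 4 ^ (-α)) c := by
  have hκ : 0 < κ := by rw [hκm]; positivity
  have onesided : ∀ {w : Rd d → ℝ} {c : ℝ}, MemLp w ∞ volume →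
      UpperSemicontinuousOn w (ball z (4 * κ)) →
      IsTestedSub s lam Lam ρ D A (ball z (4 * κ)) w → OscBound w z α κ h c →
      volume (ball z κ) ≤ 2 * volume ({x | w x ≤ c} ∩ ball z κ) →
      ∃ c', OscBound w z α (κ / 4) (h * 4 ^ (-α)) c' := by
    intro w c hw hwsc hwt Hw hhalf
    refine ⟨_, Hw.improve hκ hh P.alpha_pos P.decay (growth_lemma hd hs0 hs1 hlam hLam hκm hρ hD hD₀
      P.theta_pos P.theta_le P.alpha_pos.le P.alpha_le P.theta_small P.alpha_small hw hwsc hwt hh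
      (fun x hx => ?_) ?_ hhalf hA)⟩
    · linarith [le_of_abs_le (Hw.1 x hx)]
    · filter_upwards [Hw.2] with x hx hxκ
      linarith [le_of_abs_le (hx hxκ)]
  by_cases hhalf : volume (ball z κ) ≤ 2 * volume ({x | u x ≤ c₀} ∩ ball z κ)
  · exact onesided hu husc htest H hhalf
  · have hcover : volume (ball z κ) ≤ volume ({x | u x ≤ c₀} ∩ ball z κ) +
        volume ({x | (-u) x ≤ -c₀} ∩ ball z κ) := by
      refine (measure_mono fun x hx => ?_).trans (measure_union_le _ _)
      rcases le_total (u x) c₀ with h1 | h1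
      · exact Or.inl ⟨h1, hx⟩
      · exact Or.inr ⟨neg_le_neg h1, hx⟩
    have hhalf' : volume (ball z κ) ≤ 2 * volume ({x | (-u) x ≤ -c₀} ∩ ball z κ) := by
      by_contra hcon
      have h1 := ENNReal.add_lt_add (not_le.mp hhalf) (not_le.mp hcon)
      rw [← mul_add, ← two_mul] at h1
      exact absurd (mul_le_mul_right hcover 2) (not_le.mpr h1)
    obtain ⟨c', hc'⟩ := onesided hu.neg husc' htest' H.neg hhalf'
    have := hc'.neg
    rw [neg_neg] at this
    exact ⟨_, this⟩

/-- The essential bound holds almost everywhere; continuity extends it to every point of the open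
set. -/
theorem abs_le_supNorm_of_continuousOn {d : ℕ} {u : Rd d → ℝ} (hu : MemLp u ∞ volume)
    {Ω : Set (Rd d)} (hΩ : IsOpen Ω) (hc : ContinuousOn u Ω) : ∀ x ∈ Ω, |u x| ≤ supNorm u := by
  have h : EqOn (fun x => max |u x| (supNorm u)) (fun _ => supNorm u) Ω := by
    refine Measure.eqOn_open_of_ae_eq (μ := volume) (ae_restrict_of_ae ?_) hΩ
      (hc.abs.sup continuousOn_const) continuousOn_const
    filter_upwards [ae_abs_le_supNorm hu] with x hx
    exact max_eq_right hx
  exact fun x hx => max_eq_right_iff.mp (h hx)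

theorem oscBound_iterate {d : ℕ} (hd : 1 ≤ d) {s lam Lam ρ D D₀ A : ℝ} (hs0 : 0 < s) (hs1 : s < 1)
    (hlam : 0 < lam) (hLam : 0 < Lam) {κ θ α : ℝ} {m : ℤ} (hκm : κ = 2 ^ m)
    (hD : 0 ≤ D) (hD₀ : ∀ κ', 0 < κ' → κ' ≤ κ → D * κ' ^ (2 * s - 1) ≤ D₀)
    (P : IsDecayPair d s lam Lam D₀ θ α)
    {u : Rd d → ℝ} (hu : MemLp u ∞ volume) {z : Rd d}
    (hc : ContinuousOn u (ball z (4 * κ)))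
    (htest : IsTestedSub s lam Lam ρ D A (ball z (4 * κ)) u)
    (htest' : IsTestedSub s lam Lam ρ D A (ball z (4 * κ)) (-u)) {h : ℝ} (hh : 0 < h)
    (hsup : supNorm u ≤ h)
    (hA : A ≤ gainConst d s lam / 4 * (h * κ ^ (-(2 * s)))) (k : ℕ) :
    ρ ≤ 8 * (κ / 4 ^ k) → ∃ c, OscBound u z α (κ / 4 ^ k) (h * (4 ^ (-α)) ^ k) c := by
  have hκ : 0 < κ := by rw [hκm]; positivity
  induction k with
  | zero =>
    intro _
    refine ⟨0, fun x hx => ?_, ?_⟩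
    · simp only [pow_zero, div_one, mul_one, sub_zero] at hx ⊢
      exact (abs_le_supNorm_of_continuousOn hu isOpen_ball hc x hx).trans hsup
    · filter_upwards [ae_abs_le_supNorm hu] with x hx hxκ
      simp only [pow_zero, div_one, mul_one, sub_zero] at hxκ ⊢
      have h1 : 1 ≤ (‖x - z‖ / κ) ^ α :=
        Real.one_le_rpow (by rw [one_le_div hκ]; linarith) P.alpha_pos.le
      have h2 := mul_le_mul_of_nonneg_left h1 hh.le
      linarith
  | succ k ih =>
    intro hρ
    have h4k : (0 : ℝ) < 4 ^ k := by positivity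
    have hκk : 0 < κ / 4 ^ k := by positivity
    have hle : κ / 4 ^ k ≤ κ := div_le_self hκ.le (one_le_pow₀ (by norm_num))
    have e : κ / 4 ^ (k + 1) = κ / 4 ^ k / 4 := by rw [pow_succ, div_div]
    have hρk : ρ ≤ 8 * (κ / 4 ^ k) := by rw [e] at hρ; linarith
    obtain ⟨c, hcb⟩ := ih hρk
    have hκmk : κ / 4 ^ k = 2 ^ (m - 2 * k) := by
      rw [zpow_sub₀ two_ne_zero, hκm, zpow_mul]
      norm_num
    have hsub : ball z (4 * (κ / 4 ^ k)) ⊆ ball z (4 * κ) := ball_subset_ball (by linarith)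
    -- Each step multiplies `h * κ ^ (-2s)` by `4 ^ (2s - α) ≥ 1`, so the smallness of `A` persists.
    have hAk : A ≤ gainConst d s lam / 4 *
        (h * (4 ^ (-α)) ^ k * (κ / 4 ^ k) ^ (-(2 * s))) := by
      refine hA.trans (mul_le_mul_of_nonneg_left ?_ (by have := gainConst_pos d (s := s) hlam; positivity))
      rw [mul_assoc]
      refine mul_le_mul_of_nonneg_left ?_ hh.le
      rw [Real.div_rpow hκ.le h4k.le, Real.rpow_neg h4k.le, div_inv_eq_mul, ← Real.rpow_natCast 4 k,
        ← Real.rpow_mul (by norm_num), mul_comm (k : ℝ), Real.rpow_mul (by norm_num),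
        Real.rpow_natCast, mul_left_comm, ← mul_pow, ← Real.rpow_add (by norm_num)]
      refine le_mul_of_one_le_right (by positivity) (one_le_pow₀ ?_)
      refine Real.one_le_rpow (by norm_num) ?_
      linarith [P.alpha_le]
    have hcont := hc.mono hsub
    obtain ⟨c', hc'⟩ := hcb.step hd hs0 hs1 hlam hLam hκmk hρk hD (hD₀ _ hκk hle) P hu
      hcont.upperSemicontinuousOn hcont.neg.upperSemicontinuousOn (htest.mono hsub)
      (htest'.mono hsub) (by positivity) hAk
    refine ⟨c', ?_⟩
    rw [e, pow_succ, ← mul_assoc]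
    exact hc'

/-! ### From decay of oscillation to the Hölder estimate. -/

theorem holderEstimate_of_tested {d : ℕ} (hd : 1 ≤ d) {s lam Lam ρ D D₀ A R : ℝ} (hs0 : 0 < s)
    (hs1 : s < 1) (hlam : 0 < lam) (hLam : 0 < Lam) {θ α : ℝ} (hR : 0 < R) (hA : 0 ≤ A)
    (hD : 0 ≤ D) (hD₀ : ∀ κ, 0 < κ → κ ≤ R → D * κ ^ (2 * s - 1) ≤ D₀)
    (P : IsDecayPair d s lam Lam D₀ θ α) {u : Rd d → ℝ} (hu : MemLp u ∞ volume)
    (hc : ContinuousOn u (ball 0 R)) (htest : IsTestedSub s lam Lam ρ D A (ball 0 R) u)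
    (htest' : IsTestedSub s lam Lam ρ D A (ball 0 R) (-u)) :
    HolderEstimate s ρ R A α (2 * 32 ^ α * (1 + 4 / gainConst d s lam)) u := by
  intro x hx y hy hxy hρ
  have hg := gainConst_pos d (s := s) hlam
  set g := gainConst d s lam with hgdef
  have ht : 0 < ‖x - y‖ := norm_pos_iff.mpr (sub_ne_zero.mpr hxy)
  set t := ‖x - y‖ with htdef
  -- The starting radius is the power of 2 in `(R/16, R/8]`, so that `B_{4κ}(x)` lies in `B_R`.
  obtain ⟨m, hm1, hm2⟩ := exists_mem_Ico_zpow (x := R / 8) (y := 2) (by positivity) (by norm_num)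
  obtain ⟨κ, hκm⟩ : ∃ κ : ℝ, κ = 2 ^ m := ⟨_, rfl⟩
  have hκ : 0 < κ := by rw [hκm]; positivity
  rw [zpow_add_one₀ two_ne_zero, ← hκm] at hm2
  rw [← hκm] at hm1
  have hsub : ball x (4 * κ) ⊆ ball 0 R := by
    refine ball_subset_ball' ?_
    have := mem_ball.mp hx
    linarith
  have hR2 : κ ^ (2 * s) ≤ R ^ (2 * s) := Real.rpow_le_rpow hκ.le (by linarith) (by linarith)
  have hS : 0 ≤ supNorm u := ENNReal.toReal_nonneg
  have key : ∀ h, 0 < h → supNorm u ≤ h → A ≤ g / 4 * (h * κ ^ (-(2 * s))) →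
      |u x - u y| ≤ 2 * h * (32 * (t / R)) ^ α := by
    intro h hh hsup hAh
    by_cases htκ : 2 * κ ≤ t
    · have hsn := abs_le_supNorm_of_continuousOn hu isOpen_ball hc
      have h1 := hsn x (ball_subset_ball (by linarith) hx)
      have h2 := hsn y (ball_subset_ball (by linarith) hy)
      have h3 : 1 ≤ (32 * (t / R)) ^ α := by
        refine Real.one_le_rpow ?_ P.alpha_pos.le
        rw [← mul_div_assoc, one_le_div hR]
        linarith
      have h4 := mul_le_mul_of_nonneg_left h3 hh.le
      have h5 := abs_sub (u x) (u y)
      linarith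
    -- The scale is fixed by `κ/(2 * 4^n) < t ≤ 2κ/4^n`: the upper bound puts `y` in the oscillation
    -- ball and gives `ρ ≤ t ≤ 8κ/4^n`, the lower one gives `4^(-n) < 32t/R`.
    · obtain ⟨n, hn1, hn2⟩ := exists_nat_pow_near_of_lt_one (x := t / (2 * κ)) (y := 1 / 4)
        (by positivity) (by rw [div_le_one (by positivity)]; linarith) (by norm_num) (by norm_num)
      have hn4 : (0 : ℝ) < 4 ^ n := by positivity
      have hκn : 0 < κ / 4 ^ n := by positivity
      have htn : t ≤ 2 * (κ / 4 ^ n) := by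
        rw [div_le_iff₀ (by positivity), one_div_pow] at hn2
        calc t ≤ 1 / 4 ^ n * (2 * κ) := hn2
          _ = 2 * (κ / 4 ^ n) := by ring
      obtain ⟨c, hosc⟩ := oscBound_iterate hd hs0 hs1 hlam hLam hκm hD
        (fun κ' h1 h2 => hD₀ κ' h1 (by linarith)) P hu (hc.mono hsub) (htest.mono hsub)
        (htest'.mono hsub) hh hsup hAh n (by linarith)
      have h1 := hosc.1 x (mem_ball_self (by positivity))
      have h2 := hosc.1 y (by rw [mem_ball, dist_comm, dist_eq_norm]; linarith)
      have h3 : ((4 : ℝ) ^ (-α)) ^ n ≤ (32 * (t / R)) ^ α := by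
        have e : ((4 : ℝ) ^ (-α)) ^ n = ((1 / 4) ^ n) ^ α := by
          rw [← Real.rpow_natCast, ← Real.rpow_natCast, ← Real.rpow_mul (by norm_num),
            ← Real.rpow_mul (by norm_num), one_div, Real.inv_rpow (by norm_num),
            ← Real.rpow_neg (by norm_num)]
          ring_nf
        rw [e]
        refine Real.rpow_le_rpow (by positivity) ?_ P.alpha_pos.le
        rw [pow_succ, lt_div_iff₀ (by positivity)] at hn1
        rw [← mul_div_assoc, le_div_iff₀ hR]
        have h4 : (1 / 4 : ℝ) ^ n * R ≤ (1 / 4 : ℝ) ^ n * (16 * κ) := by gcongr; linarith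
        linarith
      have h4 := mul_le_mul_of_nonneg_left h3 hh.le
      have h5 := abs_sub_le (u x) c (u y)
      rw [abs_sub_comm c] at h5
      linarith
  have hlim : |u x - u y| ≤ 2 * (supNorm u + 4 / g * (R ^ (2 * s) * A)) * (32 * (t / R)) ^ α := by
    set T := (32 * (t / R)) ^ α
    have hT : 0 < T := by positivity
    -- `key` needs `h > 0`, which fails if `supNorm u` and `A` both vanish; `η` is the usual slack.
    refine le_of_forall_pos_le_add fun η hη => ?_
    have hAR : 0 ≤ 4 / g * (R ^ (2 * s) * A) := by positivity
    have hη' : 0 < η / (2 * T) := by positivity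
    refine (key (supNorm u + 4 / g * (R ^ (2 * s) * A) + η / (2 * T)) (by positivity) (by linarith)
      ?_).trans (le_of_eq ?_)
    · have hκs : 0 < κ ^ (-(2 * s)) := by positivity
      have e : κ ^ (2 * s) * κ ^ (-(2 * s)) = 1 := by
        rw [← Real.rpow_add hκ, add_neg_cancel, Real.rpow_zero]
      calc A = g / 4 * (4 / g * (κ ^ (2 * s) * A) * κ ^ (-(2 * s))) := by
            field_simp
            linear_combination (-A) * e
        _ ≤ g / 4 * (4 / g * (R ^ (2 * s) * A) * κ ^ (-(2 * s))) := by gcongr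
        _ ≤ _ := by gcongr; linarith
    · field_simp
  rw [div_le_iff₀ (by positivity)]
  refine hlim.trans ?_
  rw [Real.mul_rpow (by norm_num) (by positivity), Real.div_rpow ht.le hR.le]
  have h1 : supNorm u + 4 / g * (R ^ (2 * s) * A) ≤
      (1 + 4 / g) * (supNorm u + R ^ (2 * s) * A) := by
    have h2 : 0 ≤ 4 / g * supNorm u := by positivity
    have h3 : 0 ≤ R ^ (2 * s) * A := by positivity
    linarith
  calc 2 * (supNorm u + 4 / g * (R ^ (2 * s) * A)) * (32 ^ α * (t ^ α / R ^ α))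
      ≤ 2 * ((1 + 4 / g) * (supNorm u + R ^ (2 * s) * A)) * (32 ^ α * (t ^ α / R ^ α)) := by
        gcongr
    _ = _ := by ring

/-! ### Reduction of viscosity inequalities to the tested form. -/

theorem gradient_neg_eq {d : ℕ} (u : Rd d → ℝ) (x : Rd d) : gradient (-u) x = -gradient u x := by
  simp [gradient, fderiv_neg]

theorem glue_neg {d : ℕ} (x₀ : Rd d) (ε : ℝ) (φ u : Rd d → ℝ) :
    glue x₀ ε (-φ) (-u) = -glue x₀ ε φ u := by
  ext x
  by_cases h : x ∈ ball x₀ ε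
  · rw [Pi.neg_apply, glue_of_mem _ _ h, glue_of_mem _ _ h, Pi.neg_apply]
  · rw [Pi.neg_apply, glue_of_notMem _ _ h, glue_of_notMem _ _ h, Pi.neg_apply]

theorem linOp_neg {d : ℕ} (s : ℝ) (K u : Rd d → ℝ) (x : Rd d) :
    linOp s K (-u) x = -linOp s K u x := by
  unfold linOp
  rw [← integral_neg]
  congr 1
  ext y
  rw [← neg_mul]
  congr 1
  simp only [delta, gradient_neg_eq, inner_neg_left, Pi.neg_apply]
  split_ifs <;> ring

theorem IsC11OnBall.neg {d : ℕ} {φ : Rd d → ℝ} {x₀ : Rd d} {ε : ℝ} (h : IsC11OnBall φ x₀ ε) :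
    IsC11OnBall (-φ) x₀ ε := by
  obtain ⟨h1, L, h2⟩ := h
  refine ⟨h1.neg, L, fun x hx y hy => ?_⟩
  rw [gradient_neg_eq, gradient_neg_eq, edist_neg_neg]
  exact h2 hx hy

/-- An arbitrary real bound `b` on the `L_K` replaces the supremum, which removes extended reals.
The general `F` covers both cases: `D = Lam` with drift, `D = 0` without. -/
theorem ViscosityGE.isTestedSub {d : ℕ} {s lam Lam ρ D A : ℝ} {F : (Rd d → ℝ) → Rd d → EReal}
    {Ω : Set (Rd d)} {u : Rd d → ℝ}
    (hF : ∀ v x, F v x ≤ pucciPlus s lam Lam ρ v x + ((D * ‖gradient v x‖ : ℝ) : EReal))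
    (h : ViscosityGE F (fun _ => -A) Ω u) : IsTestedSub s lam Lam ρ D A Ω u := by
  intro x₀ hx₀ ε hε hball φ hφ heq hle b hb
  have h1 := (h.2.2 x₀ hx₀ ε hε hball φ hφ heq hle).trans (hF _ _)
  have h2 : pucciPlus s lam Lam ρ (glue x₀ ε φ u) x₀ ≤ (b : EReal) :=
    iSup₂_le fun K hK => EReal.coe_le_coe_iff.mpr (hb K hK)
  exact_mod_cast h1.trans (add_le_add_left h2 _)

theorem ViscosityLE.isTestedSub_neg {d : ℕ} {s lam Lam ρ D A : ℝ}
    {F : (Rd d → ℝ) → Rd d → EReal} {Ω : Set (Rd d)} {u : Rd d → ℝ}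
    (hF : ∀ v x, pucciMinus s lam Lam ρ v x - ((D * ‖gradient v x‖ : ℝ) : EReal) ≤ F v x)
    (h : ViscosityLE F (fun _ => A) Ω u) : IsTestedSub s lam Lam ρ D A Ω (-u) := by
  intro x₀ hx₀ ε hε hball φ hφ heq hle b hb
  have h1 := (hF _ _).trans (h.2.2 x₀ hx₀ ε hε hball (-φ) hφ.neg
    (by rw [Pi.neg_apply, ← heq, Pi.neg_apply, neg_neg])
    fun x hx => by have := hle x hx; simp only [Pi.neg_apply] at this ⊢; linarith)
  have e : glue x₀ ε φ (-u) = -glue x₀ ε (-φ) u := by rw [← glue_neg, neg_neg]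
  rw [e, gradient_neg_eq, norm_neg]
  have h2 : ((-b : ℝ) : EReal) ≤ pucciMinus s lam Lam ρ (glue x₀ ε (-φ) u) x₀ := by
    refine le_iInf₂ fun K hK => EReal.coe_le_coe_iff.mpr ?_
    have := hb K hK
    rw [e, linOp_neg] at this
    linarith
  have h3 := (EReal.sub_le_sub h2 le_rfl).trans h1
  rw [← EReal.coe_sub, EReal.coe_le_coe_iff] at h3
  linarith

theorem continuousOn_of_viscosity {d : ℕ} {F G : (Rd d → ℝ) → Rd d → EReal} {f g : Rd d → ℝ}
    {Ω : Set (Rd d)} {u : Rd d → ℝ} (h : ViscosityGE F f Ω u) (h' : ViscosityLE G g Ω u) :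
    ContinuousOn u Ω :=
  continuousOn_iff_lower_upperSemicontinuousOn.mpr ⟨h'.2.1, h.2.1⟩

end PartialHolder

end

theorem mainTheorem7 (d : ℕ) (hd : 1 ≤ d) (s : ℝ) (hs : s ∈ Set.Ioo (0 : ℝ) 1)
    (lam Lam : ℝ) (hlam : 0 < lam) (hLam : 0 < Lam) :
    (1 / 2 ≤ s → ∀ R₀ : ℝ, 0 < R₀ →
      ∃ α ∈ Set.Ioo (0 : ℝ) (2 * s), ∃ C : ℝ, 0 < C ∧
        ∀ ρ : ℝ, 0 ≤ ρ → ∀ A : ℝ, 0 ≤ A → ∀ R ∈ Set.Ioc (2 * ρ) R₀,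
          ∀ u : PartialHolder.Rd d → ℝ, MemLp u ∞ volume →
            PartialHolder.ViscosityGE (PartialHolder.driftPlus s lam Lam ρ)
              (fun _ => -A) (Metric.ball 0 R) u →
            PartialHolder.ViscosityLE (PartialHolder.driftMinus s lam Lam ρ)
              (fun _ => A) (Metric.ball 0 R) u →
            PartialHolder.HolderEstimate s ρ R A α C u) ∧
    (∃ α ∈ Set.Ioo (0 : ℝ) (2 * s), ∃ C : ℝ, 0 < C ∧
      ∀ ρ : ℝ, 0 ≤ ρ → ∀ A : ℝ, 0 ≤ A → ∀ R : ℝ, 2 * ρ < R →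
        ∀ u : PartialHolder.Rd d → ℝ, MemLp u ∞ volume →
          PartialHolder.ViscosityGE (PartialHolder.pucciPlus s lam Lam ρ)
            (fun _ => -A) (Metric.ball 0 R) u →
          PartialHolder.ViscosityLE (PartialHolder.pucciMinus s lam Lam ρ)
            (fun _ => A) (Metric.ball 0 R) u →
          PartialHolder.HolderEstimate s ρ R A α C u) := by
  obtain ⟨hs0, hs1⟩ := hs
  have hg := PartialHolder.gainConst_pos d (s := s) hlam
  constructor
  · intro hs2 R₀ hR₀
    -- For `s ≥ 1/2`, `κ ^ (2s - 1)` is monotone, so `D₀` bounds the relative drift at all scales up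
    -- to `R₀`.
    obtain ⟨θ, α, P⟩ := PartialHolder.exists_isDecayPair d (D₀ := Lam * R₀ ^ (2 * s - 1)) hs0 hs1
      hlam hLam (by positivity)
    have := P.alpha_pos
    refine ⟨α, ⟨this, by linarith [P.alpha_le]⟩, 2 * 32 ^ α * (1 + 4 / PartialHolder.gainConst d s lam),
      by positivity, ?_⟩
    intro ρ hρ A hA R hR u hu h1 h2
    refine PartialHolder.holderEstimate_of_tested hd hs0 hs1 hlam hLam (by linarith [hR.1]) hA
      hLam.le (fun κ hκ hκR => ?_) P hu (PartialHolder.continuousOn_of_viscosity h1 h2)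
      (h1.isTestedSub fun _ _ => le_rfl) (h2.isTestedSub_neg fun _ _ => le_rfl)
    exact mul_le_mul_of_nonneg_left
      (Real.rpow_le_rpow hκ.le (hκR.trans hR.2) (by linarith)) hLam.le
  · obtain ⟨θ, α, P⟩ := PartialHolder.exists_isDecayPair d (D₀ := 0) hs0 hs1 hlam hLam le_rfl
    have := P.alpha_pos
    refine ⟨α, ⟨this, by linarith [P.alpha_le]⟩, 2 * 32 ^ α * (1 + 4 / PartialHolder.gainConst d s lam),
      by positivity, ?_⟩
    intro ρ hρ A hA R hR u hu h1 h2
    exact PartialHolder.holderEstimate_of_tested hd hs0 hs1 hlam hLam (by linarith) hA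
      le_rfl (fun κ _ _ => by simp) P hu (PartialHolder.continuousOn_of_viscosity h1 h2)
      (h1.isTestedSub fun _ _ => by simp) (h2.isTestedSub_neg fun _ _ => by simp)
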